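/- **Conventions.** Graphs are finite metric graphs, viewed as topological spaces; loops and multiple edges are allowed. A *natural vertex* is a vertex of valence $>2$ (a loop counts twice), and a *natural edge* is an edge both of whose ends are natural vertices. A *core graph of rank $n$* is a finite connected graph without vertices of valence $1$ whose fundamental group is free of rank $n$. A *fold* $f:G\to H$ of metric graphs is the quotient map obtained as follows: take two directed natural edges $E_1,E_2$ of $G$ with the same initial vertex $v$, a number $0<L\le\min_i \mathrm{length}(E_i)$, and the isometric parametrizations $l_i:[0,L]\to E_i$ with $l_i(0)=v$, such that $l_1((0,L])\cap l_2((0,L])=\emptyset$; identify $l_1(t)$ with $l_2(t)$ for all $t\in[0,L]$, and give $H$ the quotient length metric (so $f$ is a local isometry off the folded segments and preserves length along edges). A *split sequence of rank $n$* is a sequence of folds $\zeta: G_0\xleftarrow{f_{-1}}G_{-1}\xleftarrow{f_{-2}}G_{-2}\leftarrow\cdots$ between core graphs of rank $n$ such that, for every $j<0$, the composition $G_j\to G_0$ is locally injective on the complement of the natural vertices of $G_j$. It is *proper* if the set of images in $G_0$ of the natural vertices of all $G_j$, $j<0$, is finite. The *solenoid* $X(\zeta)$ is the inverse limit $\{(x_0,x_{-1},\dots)\in\prod_{j\le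 0} G_j: f_j(x_j)=x_{j+1}\text{ for all }j<0\}$ with projections $\pi_j:X(\zeta)\to G_j$. A point $x\in X(\zeta)$ is a *pre-singularity* if there is $K\le 0$ such that $x_j$ is a natural vertex of $G_j$ for all $j\le K$. For $m\ge2$, an *$m$-pronged star set* is a set homeomorphic to $m$ copies of $[0,1)$ glued at $0$; the point corresponding to $0$ is its center (any point of a $2$-pronged star set may serve as center). A point $p\in G_k$ is *special* if $p$ is a natural vertex, or its image in some $G_j$, $j>k$, is a natural vertex, or its preimage in some $G_j$, $j<k$, contains a natural vertex. A *standard star neighborhood* in $G_k$ is an open star set containing no special point except possibly its center, and a *standard neighborhood* in $X(\zeta)$ is a set $\pi_k^{-1}(V)$ with $V$ a standard star neighborhood in $G_k$. A point $x\in X(\zeta)$ is a *singularity* if for every standard neighborhood $O\ni x$ the path component of $x$ in $O$ is an $m$-pronged star set for some $m>2$. **Proposition.** Let $n\ge1$ be an integer and let $\zeta$ be a proper split sequence of rank $n$. Then $X(\zeta)$ has at most $2(n-1)$ pre-singularities and at most $2(n-1)$ singularities. -/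

import Mathlib

open Set Topology

namespace SplitSolenoid

universe u

/-! ### Finite metric graphs -/

/-- A finite metric graph, given combinatorially. Loops, multiple edges and vertices of valence two
are allowed. Each edge carries a reference orientation from `src` to `tgt` and a positive length. -/
structure MetricGraph : Type (u + 1) where
  Vert : Type u
  Edge : Type u
  finite_vert : Finite Vert
  finite_edge : Finite Edge
  src : Edge → Vert
  tgt : Edge → Vert
  len : Edge → ℝ
  len_pos : ∀ e, 0 < len e

namespace MetricGraph

variable (G : MetricGraph.{u})

/-- The disjoint union of the vertices and of one closed interval `[0, len e]` for each edge. -/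
def Pre : Type u := G.Vert ⊕ (Σ e : G.Edge, Icc (0 : ℝ) (G.len e))

/-- The vertices are given the discrete topology. -/
instance : TopologicalSpace G.Pre :=
  letI : TopologicalSpace G.Vert := ⊥
  inferInstanceAs (TopologicalSpace (G.Vert ⊕ (Σ e : G.Edge, Icc (0 : ℝ) (G.len e))))

/-- The endpoints of the interval of an edge are glued to the end vertices of that edge. -/
inductive Glue : G.Pre → G.Pre → Prop
  | src (e : G.Edge) : Glue (Sum.inr ⟨e, ⟨0, le_rfl, (G.len_pos e).le⟩⟩) (Sum.inl (G.src e))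
  | tgt (e : G.Edge) : Glue (Sum.inr ⟨e, ⟨G.len e, (G.len_pos e).le, le_rfl⟩⟩) (Sum.inl (G.tgt e))

/-- The underlying topological space of the graph, with the quotient topology. -/
def Space : Type u := Quot G.Glue

instance : TopologicalSpace G.Space := inferInstanceAs (TopologicalSpace (Quot G.Glue))

/-- A vertex as a point of the space. -/
def vertex (v : G.Vert) : G.Space := Quot.mk _ (Sum.inl v)

/-- The point at distance `t` from the initial end of the edge `e`
(only used for `0 ≤ t ≤ len e`; other values of `t` are moved to the nearest end). -/
noncomputable def point (e : G.Edge) (t : ℝ) : G.Space :=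
  Quot.mk _ (Sum.inr ⟨e, projIcc 0 (G.len e) (G.len_pos e).le t⟩)

/-- The number of ends of edges at `v`, so that a loop counts twice. -/
noncomputable def valence (v : G.Vert) : ℕ :=
  Nat.card {e : G.Edge // G.src e = v} + Nat.card {e : G.Edge // G.tgt e = v}

/-- The set of natural vertices: the vertices of valence greater than two. -/
def naturalVertices : Set G.Space := {p | ∃ v, 2 < G.valence v ∧ p = G.vertex v}

/-- `Reach x y d`: one can move from `x` to `y` by finitely many moves, each of them inside one
edge, of total length `d`. -/
inductive Reach (x : G.Space) : G.Space → ℝ → Prop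
  | refl : Reach x x 0
  | step {d : ℝ} (e : G.Edge) (s t : ℝ) (hs : s ∈ Icc 0 (G.len e)) (ht : t ∈ Icc 0 (G.len e))
      (h : Reach x (G.point e s) d) : Reach x (G.point e t) (d + |s - t|)

/-- The path metric (infinite between different components). -/
noncomputable def pathDist (x y : G.Space) : ENNReal :=
  ⨅ (d : ℝ) (_ : G.Reach x y d), ENNReal.ofReal d

/-- A core graph of rank `n`: a (finite) connected graph without vertices of valence one, whose
fundamental group is free of rank `n`. -/
structure IsCore (n : ℕ) : Prop where
  pathConnected : PathConnectedSpace G.Space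
  valence_ne_one : ∀ v, G.valence v ≠ 1
  rank : ∀ p : G.Space, Nonempty (FundamentalGroup G.Space p ≃* FreeGroup (Fin n))

/-- A directed edge: an edge together with one of its two directions
(`true` is the reference orientation). -/
def DirEdge : Type u := G.Edge × Bool

namespace DirEdge

variable {G}

/-- The vertex where a directed edge starts. -/
def start : G.DirEdge → G.Vert
  | (e, true) => G.src e
  | (e, false) => G.tgt e

/-- The vertex where a directed edge ends. -/
def finish : G.DirEdge → G.Vert
  | (e, true) => G.tgt e
  | (e, false) => G.src e

/-- The length of a directed edge. -/
def length (E : G.DirEdge) : ℝ := G.len E.1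

/-- The isometric parametrization by `[0, length]` of a directed edge from its start. -/
noncomputable def param : G.DirEdge → ℝ → G.Space
  | (e, true), t => G.point e t
  | (e, false), t => G.point e (G.len e - t)

/-- A directed edge is natural if both its ends are natural vertices. -/
def IsNatural (E : G.DirEdge) : Prop := 2 < G.valence E.start ∧ 2 < G.valence E.finish

end DirEdge

end MetricGraph

/-! ### Folds -/

/-- `f` is the fold of `G` onto `H` along initial segments of length `L` of the directed edges
`E₁` and `E₂`. -/
structure IsFoldAlong {G H : MetricGraph.{u}} (f : G.Space → H.Space) (E₁ E₂ : G.DirEdge)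
    (L : ℝ) : Prop where
  natural₁ : E₁.IsNatural
  natural₂ : E₂.IsNatural
  start_eq : E₁.start = E₂.start
  length_pos : 0 < L
  le_length₁ : L ≤ E₁.length
  le_length₂ : L ≤ E₂.length
  disjoint : Disjoint (E₁.param '' Ioc 0 L) (E₂.param '' Ioc 0 L)
  quotientMap : IsQuotientMap f
  /-- `f` identifies `E₁.param t` with `E₂.param t` for `0 ≤ t ≤ L`, and nothing more than what
  this generates. -/
  fiber : ∀ x y, f x = f y ↔
    Relation.EqvGen (fun a b => ∃ t ∈ Icc 0 L, a = E₁.param t ∧ b = E₂.param t) x y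
  /-- Away from the folded segments, `f` is an isometry for the lengths measured along the
  graphs, that is, it preserves the path metric locally. -/
  isometry_off : ∀ p, p ∉ E₁.param '' Icc 0 L ∪ E₂.param '' Icc 0 L →
    ∃ U ∈ 𝓝 p, ∀ x ∈ U, ∀ y ∈ U, H.pathDist (f x) (f y) = G.pathDist x y
  /-- The lengths of `H` are those of the quotient also on the folded segment: `f` preserves length
  along each edge of `G`. -/
  isometry_edge : ∀ (e : G.Edge), ∀ t ∈ Icc 0 (G.len e), ∃ ε > 0,
    ∀ r ∈ Icc 0 (G.len e), ∀ s ∈ Icc 0 (G.len e), |r - t| < ε → |s - t| < ε →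
      H.pathDist (f (G.point e r)) (f (G.point e s)) = ENNReal.ofReal |r - s|

/-- `f` is a fold. -/
def IsFold {G H : MetricGraph.{u}} (f : G.Space → H.Space) : Prop :=
  ∃ (E₁ E₂ : G.DirEdge) (L : ℝ), IsFoldAlong f E₁ E₂ L

/-! ### Split sequences and their solenoids -/

/-- The composition `G j → ⋯ → G i` of the maps `f k : G (k + 1) → G k`, for `i ≤ j`. -/
def compose {G : ℕ → MetricGraph.{u}} (f : ∀ k, (G (k + 1)).Space → (G k).Space) {i j : ℕ}
    (h : i ≤ j) : (G j).Space → (G i).Space :=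
  Nat.leRecOn (C := fun m => (G m).Space → (G i).Space) h (fun {k} g => g ∘ f k) id

/-- A split sequence of rank `n`. The level written `-k` in the customary indexing by nonpositive
integers is level `k` here, so `graph k` stands for `G_{-k}` and `map k` for
`f_{-(k+1)} : G_{-(k+1)} → G_{-k}`. -/
structure SplitSequence (n : ℕ) : Type (u + 1) where
  graph : ℕ → MetricGraph.{u}
  map : ∀ k, (graph (k + 1)).Space → (graph k).Space
  core : ∀ k, (graph k).IsCore n
  fold : ∀ k, IsFold (map k)
  /-- No backtracking: each composition to level `0` is locally injective on the complement of the
  natural vertices. -/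
  noBacktracking : ∀ k, 1 ≤ k → ∀ p ∉ (graph k).naturalVertices,
    ∃ U ∈ 𝓝 p, InjOn (compose map (Nat.zero_le k)) U

/-- The model star with `m` prongs: `m` copies of `[0, 1)` glued at `0`. -/
def Star (m : ℕ) : Type :=
  Quot (fun a b : Fin m × Ico (0 : ℝ) 1 => (a.2 : ℝ) = 0 ∧ (b.2 : ℝ) = 0)

instance (m : ℕ) : TopologicalSpace (Star m) :=
  inferInstanceAs (TopologicalSpace
    (Quot (fun a b : Fin m × Ico (0 : ℝ) 1 => (a.2 : ℝ) = 0 ∧ (b.2 : ℝ) = 0)))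

/-- `c` is the center of the model star. -/
def Star.IsCenter {m : ℕ} (c : Star m) : Prop :=
  ∃ i : Fin m, c = Quot.mk _ (i, ⟨0, le_rfl, zero_lt_one⟩)

/-- `S` is an `m`-pronged star set. -/
def IsStarSet {Y : Type*} [TopologicalSpace Y] (m : ℕ) (S : Set Y) : Prop :=
  1 < m ∧ Nonempty (Star m ≃ₜ S)

/-- `S` is a star set which can be regarded as centered at `p`
(any point of a two-pronged star set can serve as its center). -/
def IsStarSetAt {Y : Type*} [TopologicalSpace Y] (S : Set Y) (p : Y) : Prop :=
  ∃ m, 1 < m ∧ ∃ (h : Star m ≃ₜ S) (c : Star m), c.IsCenter ∧ (h c : Y) = p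

namespace SplitSequence

variable {n : ℕ} (ζ : SplitSequence.{u} n)

/-- The composition of folds from level `j` to level `i`. -/
def comp {i j : ℕ} (h : i ≤ j) : (ζ.graph j).Space → (ζ.graph i).Space := compose ζ.map h

/-- A split sequence is proper if the images in level `0` of the natural vertices of all the other
levels form a finite set. -/
def IsProper : Prop :=
  {x : (ζ.graph 0).Space | ∃ j, 1 ≤ j ∧ ∃ v ∈ (ζ.graph j).naturalVertices,
    ζ.comp (Nat.zero_le j) v = x}.Finite

/-- The solenoid of `ζ`: its inverse limit, with the subspace topology of the product. -/
def Solenoid : Type u :=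
  {x : ∀ k, (ζ.graph k).Space // ∀ k, ζ.map k (x (k + 1)) = x k}

instance : TopologicalSpace ζ.Solenoid :=
  inferInstanceAs (TopologicalSpace
    {x : ∀ k, (ζ.graph k).Space // ∀ k, ζ.map k (x (k + 1)) = x k})

/-- The projection of the solenoid to level `k`. -/
def proj (k : ℕ) (x : ζ.Solenoid) : (ζ.graph k).Space := x.1 k

/-- The shadow in level `j` of a subset of level `k`: its image if level `j` lies after level `k`
along the folds, its preimage otherwise. -/
def shadow (k j : ℕ) (U : Set (ζ.graph k).Space) : Set (ζ.graph j).Space :=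
  if h : j ≤ k then ζ.comp h '' U else ζ.comp (not_le.mp h).le ⁻¹' U

/-- `p` is a special point of level `k` if its shadow in some level contains a natural vertex. -/
def IsSpecial (k : ℕ) (p : (ζ.graph k).Space) : Prop :=
  ∃ j, (ζ.shadow k j {p} ∩ (ζ.graph j).naturalVertices).Nonempty

/-- `V` is a standard star neighborhood of level `k`: an open star set without special points
except possibly its center. -/
def IsStandardStarNhd (k : ℕ) (V : Set (ζ.graph k).Space) : Prop :=
  IsOpen V ∧ ∃ p, IsStarSetAt V p ∧ ∀ q ∈ V, ζ.IsSpecial k q → q = p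

/-- A standard neighborhood in the solenoid: the preimage of a standard star neighborhood. -/
def IsStandardNhd (O : Set ζ.Solenoid) : Prop :=
  ∃ k V, ζ.IsStandardStarNhd k V ∧ O = ζ.proj k ⁻¹' V

/-- The plaque of `O` through `x`: the path component of `x` in `O`. -/
def plaque (O : Set ζ.Solenoid) (x : ζ.Solenoid) : Set ζ.Solenoid := pathComponentIn O x

/-- A singularity: for each standard neighborhood of `x`, the plaque through `x` is a star set with
more than two prongs. -/
def IsSingularity (x : ζ.Solenoid) : Prop :=
  ∀ O, ζ.IsStandardNhd O → x ∈ O → ∃ m, 2 < m ∧ IsStarSet m (ζ.plaque O x)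

/-- A pre-singularity: all coordinates from some level on are natural vertices. -/
def IsPreSingularity (x : ζ.Solenoid) : Prop :=
  ∃ K, ∀ j, K ≤ j → ζ.proj j x ∈ (ζ.graph j).naturalVertices

end SplitSequence

end SplitSolenoid

/-!
Both bounds come from counting natural vertices, once every singularity is known to be a
pre-singularity.

*Natural vertices.* In a core graph of rank `n` with `V` vertices and `E` edges the valences exceed
two by `2 (E - V)` in total, and each natural vertex contributes at least one. That `E - V + 1 ≤ n`
is read off from the fundamental group: the winding numbers of loops around the edges define a
homomorphism from it to `ℝ ^ E`; the loops that run to an edge, through it and back show that the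
image spans the space of cycles, of dimension at least `E - V + 1`, while the image of a free group
of rank `n` spans at most `n` dimensions (`MetricGraph.IsCore.card_edge_add_one_le`). Hence there
are at most `2 (n - 1)` natural vertices (`MetricGraph.IsCore.ncard_naturalVertices_le`).

*Pre-singularities.* Finitely many of them have distinct coordinates, all of them natural vertices,
at every deep enough level.

*Singularities.* Suppose that infinitely many coordinates of `x` are not natural vertices, the one
at level `j ≥ 1` being one of them. As the sequence is proper and folds have finite fibers, level `j`
has only finitely many special points, so the coordinate of `x` has an open arc `V` around it that
contains no other special point. For each deeper level `l` where the coordinate of `x` is not a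
natural vertex, the composition of folds from level `l` to level `j` is a local homeomorphism at
that coordinate and over `V` minus its center. There it is a covering map by compactness, so it has
a section over all of `V` through the coordinate of `x` (`exists_section`). The section avoids the
natural vertices, so by uniqueness of lifts every path in the plaque of `x` over `V` is carried at
level `l` by that section (`SplitSequence.exists_section_plaque`). As this holds for infinitely many
`l`, the plaque projects injectively to the arc `V`, which is impossible for a star with more than
two prongs (`not_injective_star_real`).
-/

namespace SplitSolenoid

universe u

/-! ### The topology of a metric graph -/

namespace MetricGraph

variable {G : MetricGraph.{u}}

theorem point_of_nonpos (e : G.Edge) {t : ℝ} (ht : t ≤ 0) : G.point e t = G.vertex (G.src e) := by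
  rw [point, projIcc_of_le_left _ ht]
  exact Quot.sound (Glue.src e)

theorem point_of_len_le (e : G.Edge) {t : ℝ} (ht : G.len e ≤ t) :
    G.point e t = G.vertex (G.tgt e) := by
  rw [point, projIcc_of_right_le _ ht]
  exact Quot.sound (Glue.tgt e)

theorem continuous_point (e : G.Edge) : Continuous (G.point e) := by
  let _ : TopologicalSpace G.Vert := ⊥
  exact continuous_quot_mk.comp (continuous_inr.comp (continuous_sigmaMk.comp continuous_projIcc))

theorem exists_eq_vertex_or_point (p : G.Space) :
    (∃ v, p = G.vertex v) ∨ ∃ e, ∃ t ∈ Ioo 0 (G.len e), p = G.point e t := by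
  induction p using Quot.ind with
  | mk p =>
    rcases p with v | ⟨e, t, ht⟩
    · exact Or.inl ⟨v, rfl⟩
    · have h : (Quot.mk _ (Sum.inr ⟨e, ⟨t, ht⟩⟩) : G.Space) = G.point e t := by
        rw [point, projIcc_of_mem _ ht]
      rcases ht.1.eq_or_lt with h0 | h0
      · exact Or.inl ⟨_, h.trans (point_of_nonpos e h0.ge)⟩
      rcases ht.2.eq_or_lt with h1 | h1
      · exact Or.inl ⟨_, h.trans (point_of_len_le e h1.ge)⟩
      · exact Or.inr ⟨e, t, ⟨h0, h1⟩, h⟩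

/-- A set is open if it is open along each edge: the topology at the vertices is determined by
the edges because the discrete part of the disjoint union imposes no condition. -/
theorem isOpen_iff {S : Set G.Space} : IsOpen S ↔ ∀ e, IsOpen (G.point e ⁻¹' S) := by
  refine ⟨fun h e => h.preimage (continuous_point e), fun h => ?_⟩
  let _ : TopologicalSpace G.Vert := ⊥
  have : DiscreteTopology G.Vert := ⟨rfl⟩
  change IsOpen ((Quot.mk G.Glue) ⁻¹' S)
  refine isOpen_sum_iff.2 ⟨isOpen_discrete _, isOpen_sigma_iff.2 fun e => ?_⟩
  convert! (h e).preimage continuous_subtype_val using 1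
  ext t
  exact iff_of_eq (congrArg (· ∈ S) (by simp only [point, projIcc_val]; rfl))

/-- The map out of a graph with prescribed values on the vertices and along the edges. -/
def lift {Y : Type*} (c : G.Vert → Y) (F : G.Edge → ℝ → Y) (h0 : ∀ e, F e 0 = c (G.src e))
    (h1 : ∀ e, F e (G.len e) = c (G.tgt e)) : G.Space → Y :=
  Quot.lift (Sum.elim c fun p => F p.1 p.2) (by
    rintro _ _ (e | e)
    · exact h0 e
    · exact h1 e)

section lift

variable {Y : Type*} {c : G.Vert → Y} {F : G.Edge → ℝ → Y} {h0 : ∀ e, F e 0 = c (G.src e)}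
  {h1 : ∀ e, F e (G.len e) = c (G.tgt e)}

@[simp] theorem lift_vertex (v : G.Vert) : lift c F h0 h1 (G.vertex v) = c v := rfl

theorem lift_point (e : G.Edge) {t : ℝ} (ht : t ∈ Icc 0 (G.len e)) :
    lift c F h0 h1 (G.point e t) = F e t := by
  rw [point, projIcc_of_mem _ ht]; rfl

theorem continuous_lift [TopologicalSpace Y] (hF : ∀ e, Continuous (F e)) :
    Continuous (lift c F h0 h1) := by
  let _ : TopologicalSpace G.Vert := ⊥
  have : DiscreteTopology G.Vert := ⟨rfl⟩
  refine continuous_quot_lift _ ?_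
  exact continuous_of_discreteTopology.sumElim
    (continuous_sigma fun e => (hF e).comp continuous_subtype_val)

end lift

open Classical in
/-- A normal form for points: a vertex, or an edge with an interior parameter. -/
noncomputable def code : G.Space → G.Vert ⊕ (G.Edge × ℝ) :=
  lift Sum.inl
    (fun e t => if t = 0 then Sum.inl (G.src e) else if t = G.len e then Sum.inl (G.tgt e)
      else Sum.inr (e, t)) (fun e => by simp) (fun e => by simp [(G.len_pos e).ne'])

theorem code_point {e : G.Edge} {t : ℝ} (ht : t ∈ Ioo 0 (G.len e)) :
    code (G.point e t) = Sum.inr (e, t) := by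
  rw [code, lift_point e (Ioo_subset_Icc_self ht), if_neg ht.1.ne', if_neg ht.2.ne]

theorem vertex_injective : Function.Injective G.vertex := fun v w h => by
  simpa [code] using congrArg code h

theorem point_ne_vertex {e : G.Edge} {t : ℝ} (ht : t ∈ Ioo 0 (G.len e)) (v : G.Vert) :
    G.point e t ≠ G.vertex v := fun h => by
  have := congrArg code h
  rw [code_point ht] at this
  simp [code] at this

theorem point_eq_vertex_iff {e : G.Edge} {t : ℝ} {v : G.Vert} :
    G.point e t = G.vertex v ↔ t ≤ 0 ∧ G.src e = v ∨ G.len e ≤ t ∧ G.tgt e = v := by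
  constructor
  · intro h
    rcases le_or_gt t 0 with h0 | h0
    · rw [point_of_nonpos e h0] at h
      exact Or.inl ⟨h0, vertex_injective h⟩
    rcases le_or_gt (G.len e) t with h1 | h1
    · rw [point_of_len_le e h1] at h
      exact Or.inr ⟨h1, vertex_injective h⟩
    · exact (point_ne_vertex ⟨h0, h1⟩ v h).elim
  · rintro (⟨h, rfl⟩ | ⟨h, rfl⟩)
    · exact point_of_nonpos e h
    · exact point_of_len_le e h

theorem point_eq_point_iff {e e' : G.Edge} {s t : ℝ} (ht : t ∈ Ioo 0 (G.len e')) :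
    G.point e s = G.point e' t ↔ e = e' ∧ s = t := by
  refine ⟨fun h => ?_, fun ⟨h, h'⟩ => by rw [h, h']⟩
  rcases le_or_gt s 0 with h0 | h0
  · rw [point_of_nonpos e h0] at h
    exact (point_ne_vertex ht _ h.symm).elim
  rcases le_or_gt (G.len e) s with h1 | h1
  · rw [point_of_len_le e h1] at h
    exact (point_ne_vertex ht _ h.symm).elim
  · have := congrArg code h
    rw [code_point ht, code_point ⟨h0, h1⟩] at this
    simpa using this

instance : CompactSpace G.Space := by
  let _ : TopologicalSpace G.Vert := ⊥
  have := G.finite_vert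
  have := G.finite_edge
  have : CompactSpace (Σ e : G.Edge, Icc (0 : ℝ) (G.len e)) := inferInstance
  have : CompactSpace G.Pre :=
    inferInstanceAs (CompactSpace (G.Vert ⊕ (Σ e : G.Edge, Icc (0 : ℝ) (G.len e))))
  exact Quot.compactSpace

/-- The star of radius `r` around a vertex. -/
def ball (v : G.Vert) (r : ℝ) : Set G.Space :=
  {p | p = G.vertex v ∨ ∃ e, ∃ t ∈ Ioo 0 (G.len e), p = G.point e t ∧
    (G.src e = v ∧ t < r ∨ G.tgt e = v ∧ G.len e - r < t)}

theorem point_mem_ball_iff {v : G.Vert} {r : ℝ} (hr : 0 < r) (hr' : ∀ e, r < G.len e)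
    {e : G.Edge} {t : ℝ} :
    G.point e t ∈ ball v r ↔ G.src e = v ∧ t < r ∨ G.tgt e = v ∧ G.len e - r < t := by
  have hre := hr' e
  constructor
  · rintro (h | ⟨e', t', ht', h, h'⟩)
    · rcases point_eq_vertex_iff.1 h with ⟨h, h'⟩ | ⟨h, h'⟩
      · exact Or.inl ⟨h', by linarith⟩
      · exact Or.inr ⟨h', by linarith⟩
    · obtain ⟨rfl, rfl⟩ := (point_eq_point_iff ht').1 h
      exact h'
  · intro h
    by_cases hv : G.point e t = G.vertex v
    · exact Or.inl hv
    rw [point_eq_vertex_iff, not_or, not_and, not_and] at hv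
    refine Or.inr ⟨e, t, ?_, rfl, h⟩
    rcases h with ⟨h, h'⟩ | ⟨h, h'⟩
    · exact ⟨not_le.1 fun h0 => hv.1 h0 h, by linarith⟩
    · exact ⟨by linarith, not_le.1 fun h0 => hv.2 h0 h⟩

theorem isOpen_ball (v : G.Vert) {r : ℝ} (hr : 0 < r) (hr' : ∀ e, r < G.len e) :
    IsOpen (ball v r) := by
  refine isOpen_iff.2 fun e => ?_
  have : G.point e ⁻¹' ball v r =
      {t | G.src e = v ∧ t < r} ∪ {t | G.tgt e = v ∧ G.len e - r < t} := by
    ext t; exact point_mem_ball_iff hr hr'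
  rw [this]
  exact (isOpen_const.and (isOpen_lt continuous_id continuous_const)).union
    (isOpen_const.and (isOpen_lt continuous_const continuous_id))

theorem isOpen_image_point (e : G.Edge) {a b : ℝ} (ha : 0 ≤ a) (hb : b ≤ G.len e) :
    IsOpen (G.point e '' Ioo a b) := by
  refine isOpen_iff.2 fun e' => ?_
  have : G.point e' ⁻¹' (G.point e '' Ioo a b) = {t | e' = e ∧ t ∈ Ioo a b} := by
    ext t
    constructor
    · rintro ⟨s, hs, h⟩
      obtain ⟨rfl, rfl⟩ := (point_eq_point_iff ⟨ha.trans_lt hs.1, hs.2.trans_le hb⟩).1 h.symm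
      exact ⟨rfl, hs⟩
    · rintro ⟨rfl, h⟩
      exact ⟨t, h, rfl⟩
  rw [this]
  exact isOpen_const.and isOpen_Ioo

open Classical in
/-- A continuous function taking the value `1` at `v` and `0` at the other vertices. -/
theorem exists_continuous_vertex (v : G.Vert) :
    ∃ f : G.Space → ℝ, Continuous f ∧ ∀ w, f (G.vertex w) = if w = v then 1 else 0 := by
  refine ⟨lift (fun w => if w = v then 1 else 0)
    (fun e t => (if G.src e = v then 1 else 0) * (1 - t / G.len e) +
      (if G.tgt e = v then 1 else 0) * (t / G.len e)) (fun e => by simp)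
    (fun e => by simp [(G.len_pos e).ne']), continuous_lift fun e => by fun_prop, fun w => rfl⟩

open Classical in
/-- The functions `t (len e - t)` and `t ^ 2 (len e - t)` of the parameter `t` on the edge `e`,
extended by `0`, separate the interior points of `e` from each other and from all other points. -/
theorem exists_continuous_edge (e : G.Edge) (k : ℕ) :
    ∃ f : G.Space → ℝ, Continuous f ∧ (∀ v, f (G.vertex v) = 0) ∧
      ∀ e', ∀ t ∈ Icc 0 (G.len e'),
        f (G.point e' t) = if e' = e then t ^ k * (t * (G.len e - t)) else 0 := by
  refine ⟨lift (fun _ => 0) (fun e' t => if e' = e then t ^ k * (t * (G.len e - t)) else 0)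
    (fun e' => by simp) (fun e' => by split_ifs with h <;> simp [h]),
    continuous_lift fun e' => by split_ifs <;> fun_prop, fun v => rfl,
    fun e' t ht => lift_point e' ht⟩

instance : T2Space G.Space := by
  refine ⟨fun x y hxy => ?_⟩
  suffices h : ∃ f : G.Space → ℝ, Continuous f ∧ f x ≠ f y by
    obtain ⟨f, hf, hne⟩ := h
    exact separated_by_continuous hf hne
  rcases exists_eq_vertex_or_point x with ⟨v, rfl⟩ | ⟨e, t, ht, rfl⟩
  · rcases exists_eq_vertex_or_point y with ⟨w, rfl⟩ | ⟨e, t, ht, rfl⟩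
    · obtain ⟨f, hf, h⟩ := exists_continuous_vertex v
      have hwv : w ≠ v := fun h => hxy (by rw [h])
      exact ⟨f, hf, by simp [h, hwv]⟩
    · obtain ⟨f, hf, h0, h⟩ := exists_continuous_edge e 0
      refine ⟨f, hf, ?_⟩
      rw [h0, h e t (Ioo_subset_Icc_self ht), if_pos rfl]
      have := mul_pos ht.1 (sub_pos.2 ht.2)
      simpa using this.ne
  · obtain ⟨f, hf, h0, h⟩ := exists_continuous_edge e 0
    obtain ⟨g, hg, h0', h'⟩ := exists_continuous_edge e 1
    have hpos := mul_pos ht.1 (sub_pos.2 ht.2)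
    by_cases hfxy : f (G.point e t) = f y
    · refine ⟨g, hg, fun hgxy => hxy ?_⟩
      rw [h e t (Ioo_subset_Icc_self ht), if_pos rfl] at hfxy
      rw [h' e t (Ioo_subset_Icc_self ht), if_pos rfl] at hgxy
      rcases exists_eq_vertex_or_point y with ⟨w, rfl⟩ | ⟨e', s, hs, rfl⟩
      · rw [h0] at hfxy
        simp at hfxy
        rcases hfxy with h | h
        · exact absurd h ht.1.ne'
        · linarith [ht.2]
      · rw [h _ s (Ioo_subset_Icc_self hs)] at hfxy
        rw [h' _ s (Ioo_subset_Icc_self hs)] at hgxy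
        split_ifs at hfxy hgxy with hee
        · subst hee
          simp only [pow_zero, one_mul, pow_one] at hfxy hgxy
          rw [← hfxy] at hgxy
          rw [mul_right_cancel₀ hpos.ne' hgxy]
        · simp only [pow_zero, one_mul] at hfxy
          exact absurd hfxy hpos.ne'
    · exact ⟨f, hf, hfxy⟩

end MetricGraph

/-! ### Winding numbers of paths in the circle -/

section Winding

open unitInterval

/-- The total displacement of a path in the circle `ℝ / ℤ`: the difference of the ends of a lift
to `ℝ`. -/
noncomputable def displacement {a b : AddCircle (1 : ℝ)} (γ : Path a b) : ℝ :=
  (AddCircle.isCoveringMap_coe (1 : ℝ)).liftPath γ a.out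
    (γ.source.trans (QuotientAddGroup.out_eq' a).symm) 1 - a.out

theorem displacement_eq {a b : AddCircle (1 : ℝ)} (γ : Path a b) {g : I → ℝ} (hg : Continuous g)
    (h : ∀ t, (g t : AddCircle (1 : ℝ)) = γ t) : displacement γ = g 1 - g 0 := by
  have h0 : ((a.out : ℝ) : AddCircle (1 : ℝ)) = g 0 := by
    rw [h, γ.source]; exact QuotientAddGroup.out_eq' a
  -- translating `g` by an integer makes it start where the chosen lift does
  have key := ((AddCircle.isCoveringMap_coe (1 : ℝ)).eq_liftPath_iff
    (γ.source.trans (QuotientAddGroup.out_eq' a).symm)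
    (Γ := fun t => g t + (a.out - g 0))).2 ⟨by fun_prop, by
      ext t
      simp only [Function.comp_apply, QuotientAddGroup.mk_add, QuotientAddGroup.mk_sub, h0,
        sub_self, add_zero, h]
      rfl, by simp⟩
  refine (congrArg (· - a.out) (congrFun key 1).symm).trans ?_
  ring

theorem exists_lift {a b : AddCircle (1 : ℝ)} (γ : Path a b) :
    ∃ g : I → ℝ, Continuous g ∧ ∀ t, (g t : AddCircle (1 : ℝ)) = γ t := by
  have cov := AddCircle.isCoveringMap_coe (1 : ℝ)
  have h0 := γ.source.trans (QuotientAddGroup.out_eq' a).symm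
  exact ⟨cov.liftPath γ _ h0, (cov.liftPath γ _ h0).continuous,
    fun t => congrFun (cov.liftPath_lifts γ _ h0) t⟩

theorem displacement_trans {a b c : AddCircle (1 : ℝ)} (γ : Path a b) (γ' : Path b c) :
    displacement (γ.trans γ') = displacement γ + displacement γ' := by
  have cov := AddCircle.isCoveringMap_coe (1 : ℝ)
  have h := cov.liftPath_trans (QuotientAddGroup.out_eq' a).symm γ γ'
  have h' := displacement_eq γ' (g := cov.liftPath γ' _ (by
    simpa using congr($(cov.liftPath_lifts γ _
      (γ.source.trans (QuotientAddGroup.out_eq' a).symm)) 1).symm)) (ContinuousMap.continuous _)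
    (fun t => congrFun (cov.liftPath_lifts γ' _ _) t)
  rw [h', cov.liftPath_zero, displacement, h, displacement]
  simp

theorem displacement_symm {a b : AddCircle (1 : ℝ)} (γ : Path a b) :
    displacement γ.symm = -displacement γ := by
  obtain ⟨g, hg, h⟩ := exists_lift γ
  rw [displacement_eq γ hg h, displacement_eq γ.symm (g := fun t => g (σ t)) (by fun_prop)
    (fun t => h _)]
  simp

theorem displacement_eq_of_homotopic {a b : AddCircle (1 : ℝ)} {γ γ' : Path a b}
    (h : γ.Homotopic γ') : displacement γ = displacement γ' :=
  congrArg (· - a.out)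
    ((AddCircle.isCoveringMap_coe (1 : ℝ)).liftPath_apply_one_eq_of_homotopicRel h _ _ _)

/-- The homomorphism from a fundamental group to `ℝ^ι` given by the winding numbers of the images
of loops under a family of maps to the circle. -/
noncomputable def windingHom {X ι : Type*} [TopologicalSpace X]
    (φ : ι → C(X, AddCircle (1 : ℝ))) (p : X) :
    FundamentalGroup X p →* Multiplicative (ι → ℝ) :=
  MonoidHom.mk' (fun q => Multiplicative.ofAdd fun i =>
    Quotient.lift (s := Path.Homotopic.setoid p p)
      (fun γ : Path p p => displacement (γ.map (φ i).continuous))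
      (fun _ _ h => displacement_eq_of_homotopic (h.map (φ i))) q) (by
    rintro ⟨γ⟩ ⟨γ'⟩
    refine congrArg Multiplicative.ofAdd (funext fun i => ?_)
    change displacement ((γ'.trans γ).map (φ i).continuous) =
      displacement (γ.map (φ i).continuous) + displacement (γ'.map (φ i).continuous)
    rw [Path.map_trans, displacement_trans, add_comm])

theorem windingHom_mk {X ι : Type*} [TopologicalSpace X] (φ : ι → C(X, AddCircle (1 : ℝ))) {p : X}
    (γ : Path p p) : Multiplicative.toAdd (windingHom φ p (Path.Homotopic.Quotient.mk γ)) =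
      fun i => displacement (γ.map (φ i).continuous) := rfl

end Winding

/-- The image of a free group of rank `n` in a real vector space spans at most `n` dimensions. -/
theorem finrank_span_range_le {n : ℕ} {W : Type*} [AddCommGroup W] [Module ℝ W]
    (h : FreeGroup (Fin n) →* Multiplicative W) :
    Module.finrank ℝ (Submodule.span ℝ (range fun g => Multiplicative.toAdd (h g))) ≤ n := by
  have hspan : Submodule.span ℝ (range fun g => Multiplicative.toAdd (h g)) =
      Submodule.span ℝ (range fun i => Multiplicative.toAdd (h (FreeGroup.of i))) := by
    refine le_antisymm (Submodule.span_le.2 ?_) (Submodule.span_mono ?_)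
    · rintro _ ⟨g, rfl⟩
      induction g using FreeGroup.induction_on with
      | C1 => simp
      | of i => exact Submodule.subset_span ⟨i, rfl⟩
      | inv_of i ih => simpa using ih
      | mul x y hx hy => simpa using add_mem hx hy
    · rintro _ ⟨i, rfl⟩
      exact ⟨FreeGroup.of i, rfl⟩
  rw [hspan]
  exact (finrank_range_le_card (R := ℝ) fun i => Multiplicative.toAdd (h (FreeGroup.of i))).trans
    (Fintype.card_fin n).le

/-! ### The Euler characteristic and the number of natural vertices -/

namespace MetricGraph

variable {G : MetricGraph.{u}}

open Classical in
/-- The map to the circle that wraps the edge `e` once around and collapses everything else. -/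
noncomputable def wrap (e : G.Edge) : C(G.Space, AddCircle (1 : ℝ)) where
  toFun := lift (fun _ => 0) (fun e' t => if e' = e then ((t / G.len e : ℝ) : AddCircle (1 : ℝ))
    else 0) (fun e' => by simp) (fun e' => by
      split_ifs with h
      · rw [h, div_self (G.len_pos e).ne', AddCircle.coe_period]
      · rfl)
  continuous_toFun := continuous_lift fun e' => by
    split_ifs
    · exact continuous_quot_mk.comp (by fun_prop)
    · fun_prop

open Classical in
theorem wrap_point (e' e : G.Edge) {t : ℝ} (ht : t ∈ Icc 0 (G.len e)) :
    wrap e' (G.point e t) = if e = e' then ((t / G.len e' : ℝ) : AddCircle (1 : ℝ)) else 0 := by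
  rw [wrap, ContinuousMap.coe_mk, lift_point e ht]

/-- The path that runs through an edge. -/
noncomputable def edgePath (e : G.Edge) : Path (G.vertex (G.src e)) (G.vertex (G.tgt e)) where
  toFun t := G.point e (t * G.len e)
  continuous_toFun := (continuous_point e).comp (by fun_prop)
  source' := point_of_nonpos e (by simp)
  target' := point_of_len_le e (by simp)

open Classical in
theorem displacement_wrap_edgePath (e e' : G.Edge) :
    displacement ((edgePath e).map (wrap e').continuous) = (Pi.single e 1 : G.Edge → ℝ) e' := by
  have hmem (t : unitInterval) : t * G.len e ∈ Icc 0 (G.len e) :=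
    ⟨mul_nonneg t.2.1 (G.len_pos e).le, mul_le_of_le_one_left (G.len_pos e).le t.2.2⟩
  have hw (t : unitInterval) : ((edgePath e).map (wrap e').continuous) t =
      if e = e' then ((t * G.len e / G.len e' : ℝ) : AddCircle (1 : ℝ)) else 0 :=
    wrap_point e' e (hmem t)
  by_cases h : e = e'
  · subst h
    rw [displacement_eq _ (g := fun t => t) continuous_subtype_val fun t => ?_]
    · simp
    · rw [hw, if_pos rfl, mul_div_cancel_right₀ _ (G.len_pos e).ne']
  · rw [displacement_eq _ (g := fun _ => 0) continuous_const fun t => ?_]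
    · simp [Ne.symm h]
    · rw [hw, if_neg h]; rfl

/-- The first Betti number of a connected graph is at most the rank of its fundamental group:
winding numbers around the edges map loops to cycles, and the loops that run to an edge, through
the edge and back span the space of cycles. -/
theorem IsCore.card_edge_add_one_le {n : ℕ} (hG : G.IsCore n) :
    Nat.card G.Edge + 1 ≤ n + Nat.card G.Vert := by
  classical
  have := G.finite_vert
  have := G.finite_edge
  have := Fintype.ofFinite G.Vert
  have := Fintype.ofFinite G.Edge
  have := hG.pathConnected
  have p : G.Space := Classical.arbitrary G.Space
  have hV : Nonempty G.Vert := by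
    rcases exists_eq_vertex_or_point p with ⟨v, -⟩ | ⟨e, -⟩
    exacts [⟨v⟩, ⟨G.src e⟩]
  obtain ⟨iso⟩ := hG.rank p
  let S : Submodule ℝ (G.Edge → ℝ) := Submodule.span ℝ
    (range fun g => Multiplicative.toAdd ((windingHom wrap p).comp iso.symm.toMonoidHom g))
  have hn : Module.finrank ℝ S ≤ n := finrank_span_range_le _
  have hmem (γ : Path p p) : (fun e => displacement (γ.map (wrap e).continuous)) ∈ S :=
    Submodule.subset_span ⟨iso (Path.Homotopic.Quotient.mk γ), by simp [windingHom_mk]⟩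
  -- the windings of a path from the base point to each vertex
  let α (v : G.Vert) : Path p (G.vertex v) := PathConnectedSpace.somePath _ _
  let A (v : G.Vert) : G.Edge → ℝ := fun e => displacement ((α v).map (wrap e).continuous)
  have hloop (e : G.Edge) : Pi.single e 1 + A (G.src e) - A (G.tgt e) ∈ S := by
    convert! hmem (((α (G.src e)).trans (edgePath e)).trans (α (G.tgt e)).symm) using 1
    ext e'
    rw [Path.map_trans, Path.map_trans, displacement_trans, displacement_trans,
      displacement_wrap_edgePath, ← Path.map_symm, displacement_symm]
    simp only [Pi.sub_apply, Pi.add_apply, A]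
    ring
  let D : (G.Edge → ℝ) →ₗ[ℝ] (G.Vert → ℝ) := Fintype.linearCombination ℝ
    fun e => Pi.single (G.tgt e) (1 : ℝ) - Pi.single (G.src e) 1
  have hker : LinearMap.ker D ≤ S := by
    intro z hz
    have hA : ∑ e, z e • (A (G.tgt e) - A (G.src e)) = 0 := by
      have := congrArg (Fintype.linearCombination ℝ A) (LinearMap.mem_ker.1 hz)
      rw [Fintype.linearCombination_apply ℝ _ z, map_sum, map_zero] at this
      simpa [Fintype.linearCombination_apply_single] using this
    have hz' : z = ∑ e, z e • (Pi.single e 1 + A (G.src e) - A (G.tgt e)) := by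
      have h1 : z = ∑ e, z e • (Pi.single e 1 : G.Edge → ℝ) := by
        ext e; simp [Finset.sum_apply, Pi.single_apply]
      conv_lhs => rw [h1, ← sub_zero (∑ e, z e • (Pi.single e 1 : G.Edge → ℝ)), ← hA,
        ← Finset.sum_sub_distrib]
      refine Finset.sum_congr rfl fun e _ => ?_
      rw [← smul_sub]
      congr 1
      abel
    rw [hz']
    exact sum_mem fun e _ => S.smul_mem _ (hloop e)
  -- the coordinates of a boundary add up to zero
  let s : (G.Vert → ℝ) →ₗ[ℝ] ℝ := Fintype.linearCombination ℝ fun _ => (1 : ℝ)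
  have hDs : LinearMap.range D ≤ LinearMap.ker s := by
    rintro _ ⟨z, rfl⟩
    rw [LinearMap.mem_ker, Fintype.linearCombination_apply ℝ _ z, map_sum]
    refine Finset.sum_eq_zero fun e _ => ?_
    rw [map_smul, map_sub, Fintype.linearCombination_apply_single,
      Fintype.linearCombination_apply_single]
    simp
  have hs : Module.finrank ℝ (LinearMap.range s) = 1 := by
    rw [LinearMap.range_eq_top.2, finrank_top, Module.finrank_self]
    intro r
    obtain ⟨v⟩ := hV
    exact ⟨Pi.single v r, by rw [Fintype.linearCombination_apply_single]; simp⟩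
  have h1 := LinearMap.finrank_range_add_finrank_ker D
  have h2 := LinearMap.finrank_range_add_finrank_ker s
  have h3 := Submodule.finrank_mono hDs
  have h4 := Submodule.finrank_mono hker
  rw [Module.finrank_fintype_fun_eq_card] at h1 h2
  rw [Nat.card_eq_fintype_card, Nat.card_eq_fintype_card]
  omega

theorem sum_valence [Fintype G.Vert] : ∑ v, G.valence v = 2 * Nat.card G.Edge := by
  have := G.finite_edge
  have h (f : G.Edge → G.Vert) : ∑ v, Nat.card {e // f e = v} = Nat.card G.Edge := by
    rw [← Nat.card_sigma, Nat.card_congr (Equiv.sigmaFiberEquiv f)]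
  simp only [valence, Finset.sum_add_distrib, h]
  ring

/-- In a connected graph with an edge no vertex is isolated. -/
theorem valence_ne_zero [PathConnectedSpace G.Space] (e₀ : G.Edge) (v : G.Vert) :
    G.valence v ≠ 0 := by
  intro hv
  have := G.finite_edge
  rw [valence, Nat.add_eq_zero_iff, Finite.card_eq_zero_iff, Finite.card_eq_zero_iff] at hv
  have hopen : IsOpen {G.vertex v} := by
    refine isOpen_iff.2 fun e => ?_
    convert! isOpen_empty
    ext t
    simp only [mem_preimage, mem_singleton_iff, point_eq_vertex_iff, mem_empty_iff_false, iff_false]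
    rintro (⟨-, h⟩ | ⟨-, h⟩)
    · exact hv.1.false ⟨e, h⟩
    · exact hv.2.false ⟨e, h⟩
  have huniv := IsClopen.eq_univ ⟨isClosed_singleton, hopen⟩ (singleton_nonempty (G.vertex v))
  have hmem : G.point e₀ (G.len e₀ / 2) ∈ ({G.vertex v} : Set G.Space) := huniv ▸ mem_univ _
  have := G.len_pos e₀
  exact point_ne_vertex ⟨by linarith, by linarith⟩ v hmem

theorem IsCore.two_le_valence {n : ℕ} (hG : G.IsCore n) (e₀ : G.Edge) (v : G.Vert) :
    2 ≤ G.valence v := by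
  have := hG.pathConnected
  have h0 := valence_ne_zero e₀ v
  have h1 := hG.valence_ne_one v
  omega

theorem finite_naturalVertices : G.naturalVertices.Finite := by
  have := G.finite_vert
  refine (finite_range G.vertex).subset ?_
  rintro _ ⟨v, -, rfl⟩
  exact ⟨v, rfl⟩

/-- The valences exceed two by `2 (E - V) ≤ 2 (n - 1)` in total, and each natural vertex
contributes at least one. -/
theorem IsCore.ncard_naturalVertices_le {n : ℕ} (hG : G.IsCore n) (e₀ : G.Edge) :
    G.naturalVertices.ncard ≤ 2 * (n - 1) := by
  classical
  have := G.finite_vert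
  have := Fintype.ofFinite G.Vert
  have hN : G.naturalVertices = G.vertex '' ↑(Finset.univ.filter fun v => 2 < G.valence v) := by
    ext p
    simp [naturalVertices, eq_comm]
  rw [hN, ncard_image_of_injective _ vertex_injective, ncard_coe_finset]
  have hle : ∑ v, (2 + if 2 < G.valence v then 1 else 0) ≤ ∑ v, G.valence v :=
    Finset.sum_le_sum fun v _ => by
      have := hG.two_le_valence e₀ v
      split_ifs <;> omega
  rw [Finset.sum_add_distrib, ← Finset.card_filter, sum_valence, Finset.sum_const,
    Finset.card_univ, ← Nat.card_eq_fintype_card] at hle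
  have := hG.card_edge_add_one_le
  simp only [smul_eq_mul] at hle
  omega

end MetricGraph

/-! ### Arcs -/

section Arc

variable {X Y : Type*} [TopologicalSpace X] [TopologicalSpace Y]

/-- `a` parametrizes an open neighborhood of `p` by the line, with `a 0 = p`. -/
def IsArcAt (a : ℝ → Y) (p : Y) : Prop := IsOpenEmbedding a ∧ a 0 = p

theorem exists_isOpenEmbedding_real {r : ℝ} (hr : 0 < r) :
    ∃ g : ℝ → ℝ, IsOpenEmbedding g ∧ g 0 = 0 ∧ range g = Ioo (-r) r := by
  refine ⟨OpenPartialHomeomorph.univBall 0 r,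
    (OpenPartialHomeomorph.univBall 0 r).isOpenEmbedding (by simp), by simp, ?_⟩
  rw [← image_univ, ← OpenPartialHomeomorph.univBall_source (0 : ℝ) r,
    OpenPartialHomeomorph.image_source_eq_target, OpenPartialHomeomorph.univBall_target _ hr,
    Real.ball_eq_Ioo]
  simp

theorem IsArcAt.exists_subset {a : ℝ → Y} {p : Y} (ha : IsArcAt a p) {W : Set Y} (hW : W ∈ 𝓝 p) :
    ∃ b : ℝ → Y, IsArcAt b p ∧ range b ⊆ W := by
  have hW' : a ⁻¹' W ∈ 𝓝 (0 : ℝ) := ha.1.continuous.continuousAt.preimage_mem_nhds (ha.2 ▸ hW)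
  obtain ⟨r, hr, hrW⟩ := Metric.mem_nhds_iff.1 hW'
  obtain ⟨g, hg, hg0, hgr⟩ := exists_isOpenEmbedding_real hr
  refine ⟨a ∘ g, ⟨ha.1.comp hg, by simp [hg0, ha.2]⟩, ?_⟩
  rintro _ ⟨t, rfl⟩
  refine hrW ?_
  rw [Real.ball_eq_Ioo, zero_sub, zero_add, ← hgr]
  exact mem_range_self t

/-- Injectivity on a compact interval makes a path an embedding, and an open image then makes it an
open embedding of the open interval: the image of an open subset is the complement in the open
image of a compact set. -/
theorem exists_isArcAt_of_injOn [T2Space Y] {a : ℝ → Y} {r : ℝ} (hr : 0 < r) (ha : Continuous a)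
    (hinj : InjOn a (Icc (-r) r)) (hopen : IsOpen (a '' Ioo (-r) r)) :
    ∃ b : ℝ → Y, IsArcAt b (a 0) := by
  obtain ⟨g, hg, hg0, hgr⟩ := exists_isOpenEmbedding_real hr
  have hmem (t : ℝ) : g t ∈ Ioo (-r) r := hgr ▸ mem_range_self t
  refine ⟨a ∘ g, IsOpenEmbedding.of_continuous_injective_isOpenMap (ha.comp hg.continuous)
    (fun s t h => hg.injective (hinj (Ioo_subset_Icc_self (hmem s))
      (Ioo_subset_Icc_self (hmem t)) h)) (fun U hU => ?_), by simp [hg0]⟩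
  have hgU : g '' U ⊆ Ioo (-r) r := by
    rintro _ ⟨t, -, rfl⟩; exact hmem t
  have hclosed : IsClosed (a '' (Icc (-r) r \ g '' U)) :=
    ((isCompact_Icc.diff (hg.isOpenMap U hU)).image ha).isClosed
  have : a ∘ g '' U = a '' Ioo (-r) r \ a '' (Icc (-r) r \ g '' U) := by
    rw [image_comp]
    apply subset_antisymm
    · rintro _ ⟨t, ht, rfl⟩
      refine ⟨⟨t, hgU ht, rfl⟩, ?_⟩
      rintro ⟨s, ⟨hs, hs'⟩, hst⟩
      exact hs' (hinj hs (Ioo_subset_Icc_self (hgU ht)) hst ▸ ht)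
    · rintro _ ⟨⟨t, ht, rfl⟩, h⟩
      exact ⟨t, by_contra fun h' => h ⟨t, ⟨Ioo_subset_Icc_self ht, h'⟩, rfl⟩, rfl⟩
  rw [this]
  exact hopen.sdiff hclosed

theorem isOpenEmbedding_of_injective_real {g : ℝ → ℝ} (hg : Continuous g)
    (hinj : Function.Injective g) : IsOpenEmbedding g := by
  refine IsOpenEmbedding.of_continuous_injective_isOpenMap hg hinj
    (isOpenMap_iff_nhds_le.2 fun t s hs => ?_)
  obtain ⟨r, hr, hrs⟩ := Metric.nhds_basis_closedBall.mem_iff.1 (Filter.mem_map.1 hs)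
  rw [Real.closedBall_eq_Icc] at hrs
  have hc : ContinuousOn g (Icc (t - r) (t + r)) := hg.continuousOn
  rcases hg.strictMono_of_inj hinj with h | h
  · refine Filter.mem_of_superset
      (Icc_mem_nhds (h (sub_lt_self t hr)) (h (lt_add_of_pos_right t hr))) fun y hy => ?_
    obtain ⟨x, hx, rfl⟩ := intermediate_value_Icc (by linarith) hc hy
    exact hrs hx
  · refine Filter.mem_of_superset
      (Icc_mem_nhds (h (lt_add_of_pos_right t hr)) (h (sub_lt_self t hr))) fun y hy => ?_
    obtain ⟨x, hx, rfl⟩ := intermediate_value_Icc' (by linarith) hc hy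
    exact hrs hx

/-- Invariance of domain in dimension one. -/
theorem isLocalHomeomorphOn_of_injOn {f : X → Y} (hf : Continuous f) {x : X} {b : ℝ → X}
    (hb : IsArcAt b x) {a : ℝ → Y} (ha : IsOpenEmbedding a) (hfx : f x ∈ range a) {U : Set X}
    (hU : U ∈ 𝓝 x) (hinj : InjOn f U) : IsLocalHomeomorphOn f {x} := by
  obtain ⟨c, hc, hcU⟩ := hb.exists_subset (Filter.inter_mem hU
    (hf.continuousAt.preimage_mem_nhds (ha.isOpen_range.mem_nhds hfx)))
  -- read in the two charts, `f` is an injective continuous map `g` of the line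
  choose g hg using fun t => (hcU (mem_range_self t)).2
  have hfc : Continuous (a ∘ g) := by
    rw [show a ∘ g = f ∘ c from funext hg]; exact hf.comp hc.1.continuous
  have hginj : Function.Injective g := fun s t h => hc.1.injective
    (hinj (hcU (mem_range_self s)).1 (hcU (mem_range_self t)).1 (by rw [← hg, ← hg, h]))
  have hfc' : IsOpenEmbedding (f ∘ c) := by
    rw [← show a ∘ g = f ∘ c from funext hg]
    exact ha.comp (isOpenEmbedding_of_injective_real (ha.isInducing.continuous_iff.2 hfc) hginj)
  have := IsLocalHomeomorphOn.of_comp_right (s := {0})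
    (hfc'.isLocalHomeomorph.isLocalHomeomorphOn)
    (hc.1.isLocalHomeomorph.isLocalHomeomorphOn)
  simpa [hc.2] using this

/-- Two maps with the same composition with `f` agree if they agree somewhere and `f` is locally
injective wherever they agree. -/
theorem eq_of_comp_eq_of_locally_injOn {A X Y : Type*} [TopologicalSpace A] [PreconnectedSpace A]
    [TopologicalSpace X] [T2Space X] {f : X → Y} {g₁ g₂ : A → X} (h₁ : Continuous g₁)
    (h₂ : Continuous g₂) (hf : ∀ t, f (g₁ t) = f (g₂ t)) (hloc : ∀ t, g₁ t = g₂ t → ∃ U ∈ 𝓝 (g₁ t), InjOn f U)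
    {t₀ : A} (h₀ : g₁ t₀ = g₂ t₀) (t : A) : g₁ t = g₂ t := by
  have hopen : IsOpen {t | g₁ t = g₂ t} := isOpen_iff_mem_nhds.2 fun t ht => by
    obtain ⟨U, hU, hinj⟩ := hloc t ht
    filter_upwards [h₁.continuousAt.preimage_mem_nhds hU,
      h₂.continuousAt.preimage_mem_nhds (ht ▸ hU)] with s hs₁ hs₂
    exact hinj hs₁ hs₂ (hf s)
  have := IsClopen.eq_univ ⟨isClosed_eq h₁ h₂, hopen⟩ ⟨t₀, h₀⟩
  exact (this.symm ▸ mem_univ t : t ∈ {t | g₁ t = g₂ t})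

/-- A local section of `f` over an initial part of one half of an arc extends to that whole half,
because `f` is a covering map there. -/
theorem exists_section_Ioi [T2Space X] [CompactSpace X] [T2Space Y] {f : X → Y} (hf : Continuous f)
    {a : ℝ → Y} (ha : IsOpenEmbedding a) (hloc : IsLocalHomeomorphOn f (f ⁻¹' (a '' {0}ᶜ)))
    {r : ℝ} (hr : 0 < r) {s₀ : ℝ → X} (hs₀ : ContinuousOn s₀ (Ioo (-r) r))
    (hfs₀ : ∀ t ∈ Ioo (-r) r, f (s₀ t) = a t) :
    ∃ s : ℝ → X, ContinuousOn s (Ioi 0) ∧ (∀ t > 0, f (s t) = a t) ∧ ∀ t ∈ Ioo 0 r, s t = s₀ t := by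
  have cov := IsCoveringMapOn.of_isLocalHomeomorphOn hf hloc
  -- the half-line is parametrized by the simply connected space `ℝ` through the exponential map
  have hr2 : r / 2 ∈ Ioo (-r) r := ⟨by linarith, by linarith⟩
  obtain ⟨F, ⟨hF0, hF⟩, -⟩ := cov.existsUnique_continuousMap_lifts
    (A := ℝ) ⟨fun t => a (Real.exp t), ha.continuous.comp Real.continuous_exp⟩
    (a₀ := Real.log (r / 2)) (e₀ := s₀ (r / 2))
    (by simp [hfs₀ _ hr2, Real.exp_log (half_pos hr)])
    (fun t => ⟨_, (Real.exp_pos t).ne', rfl⟩)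
  have hFs (t : ℝ) (ht : 0 < t) : f (F (Real.log t)) = a t := by
    simpa [Real.exp_log ht] using congrFun hF (Real.log t)
  have hFc : ContinuousOn (fun t => F (Real.log t)) (Ioi 0) := fun t ht =>
    (F.continuous.continuousAt.comp (Real.continuousAt_log (ne_of_gt ht))).continuousWithinAt
  refine ⟨fun t => F (Real.log t), hFc, hFs, fun t ht => ?_⟩
  have hsub : Ioo 0 r ⊆ Ioo (-r) r := Ioo_subset_Ioo_left (by linarith)
  have : PreconnectedSpace (Ioo 0 r) := isPreconnected_iff_preconnectedSpace.1 isPreconnected_Ioo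
  refine eq_of_comp_eq_of_locally_injOn (A := Ioo 0 r) (f := f)
    (g₁ := fun t => F (Real.log t)) (g₂ := fun t => s₀ t)
    (continuousOn_iff_continuous_domRestrict.1 (hFc.mono fun t ht => ht.1))
    (continuousOn_iff_continuous_domRestrict.1 (hs₀.mono hsub))
    (fun t => by rw [hFs _ t.2.1, hfs₀ _ (hsub t.2)]) (fun t _ => ?_)
    (t₀ := ⟨r / 2, half_pos hr, half_lt_self hr⟩) hF0 ⟨t, ht⟩
  obtain ⟨φ, hφ, hfφ⟩ := hloc (F (Real.log t)) ⟨t, (t.2.1).ne', (hFs _ t.2.1).symm⟩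
  exact ⟨φ.source, φ.open_source.mem_nhds hφ, hfφ ▸ φ.injOn⟩

/-- If `f` is a local homeomorphism at all points over an arc, except possibly at some points over
its center, then `f` has a section over the arc through any point over the center at which it is a
local homeomorphism. -/
theorem exists_section [T2Space X] [CompactSpace X] [T2Space Y] {f : X → Y} (hf : Continuous f)
    {a : ℝ → Y} (ha : IsOpenEmbedding a) (hloc : IsLocalHomeomorphOn f (f ⁻¹' (a '' {0}ᶜ)))
    {x : X} (hx : f x = a 0) (hlocx : IsLocalHomeomorphOn f {x}) :
    ∃ s : ℝ → X, Continuous s ∧ (∀ t, f (s t) = a t) ∧ s 0 = x := by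
  obtain ⟨φ, hφ, rfl⟩ := hlocx x rfl
  have hnhds : a ⁻¹' φ.target ∈ 𝓝 (0 : ℝ) := ha.continuous.continuousAt.preimage_mem_nhds
    (hx ▸ φ.open_target.mem_nhds (φ.map_source hφ))
  obtain ⟨r, hr, hrφ⟩ := Metric.mem_nhds_iff.1 hnhds
  rw [Real.ball_eq_Ioo, zero_sub, zero_add] at hrφ
  set s₀ : ℝ → X := fun t => φ.symm (a t)
  have hs₀ : ContinuousOn s₀ (Ioo (-r) r) :=
    φ.continuousOn_symm.comp ha.continuous.continuousOn hrφ
  have hfs₀ : ∀ t ∈ Ioo (-r) r, φ (s₀ t) = a t := fun t ht => φ.right_inv (hrφ ht)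
  have hs₀0 : s₀ 0 = x := by simp only [s₀, ← hx]; exact φ.left_inv hφ
  have hneg : MapsTo (fun t : ℝ => -t) (Ioo (-r) r) (Ioo (-r) r) := fun t ht =>
    ⟨by linarith [ht.2], by linarith [ht.1]⟩
  have himage : (a ∘ fun t => -t) '' {0}ᶜ = a '' {0}ᶜ := by
    rw [image_comp, image_neg_eq_neg]
    congr 1
    ext t; simp
  obtain ⟨s₁, hs₁, hfs₁, hss₁⟩ := exists_section_Ioi hf ha hloc hr hs₀ hfs₀
  obtain ⟨s₂, hs₂, hfs₂, hss₂⟩ := exists_section_Ioi hf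
    (ha.comp (Homeomorph.neg ℝ).isOpenEmbedding) (by rw [← himage] at hloc; exact hloc) hr
    (s₀ := fun t => s₀ (-t)) (hs₀.comp continuous_neg.continuousOn hneg)
    (fun t ht => hfs₀ _ (hneg ht))
  refine ⟨fun t => if 0 < t then s₁ t else if t < 0 then s₂ (-t) else x, ?_, fun t => ?_, by simp⟩
  · refine continuous_iff_continuousAt.2 fun t => ?_
    rcases lt_trichotomy t 0 with ht | rfl | ht
    · have hc : ContinuousAt (fun t => s₂ (-t)) t :=
        ContinuousAt.comp (g := s₂) (hs₂.continuousAt (Ioi_mem_nhds (neg_pos.2 ht)))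
          continuous_neg.continuousAt
      refine hc.congr ?_
      filter_upwards [Iio_mem_nhds ht] with u hu
      rw [if_neg (not_lt.2 (le_of_lt hu)), if_pos (mem_Iio.1 hu)]
    · refine (hs₀.continuousAt (Ioo_mem_nhds (neg_lt_zero.2 hr) hr)).congr ?_
      filter_upwards [Ioo_mem_nhds (neg_lt_zero.2 hr) hr] with u hu
      rcases lt_trichotomy u 0 with h | rfl | h
      · rw [if_neg (not_lt.2 h.le), if_pos h, hss₂ _ ⟨neg_pos.2 h, by linarith [hu.1]⟩, neg_neg]
      · simpa using hs₀0
      · rw [if_pos h, hss₁ _ ⟨h, hu.2⟩]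
    · refine (hs₁.continuousAt (Ioi_mem_nhds ht)).congr ?_
      filter_upwards [Ioi_mem_nhds ht] with u hu
      rw [if_pos (mem_Ioi.1 hu)]
  · dsimp only
    split_ifs with h h'
    · exact hfs₁ t h
    · simpa using hfs₂ (-t) (neg_pos.2 h')
    · rw [hx, le_antisymm (not_lt.1 h) (not_lt.1 h')]

end Arc

/-! ### Star sets -/

/-- The model star with two prongs is an open interval centered at `0`. -/
theorem exists_homeomorph_star_two :
    ∃ h : Star 2 ≃ₜ Ioo (-1 : ℝ) 1, ∃ c : Star 2, c.IsCenter ∧ (h c : ℝ) = 0 := by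
  have hIco (t : Ico (0 : ℝ) 1) : (t : ℝ) ∈ Ioo (-1 : ℝ) 1 :=
    ⟨by linarith [t.2.1], t.2.2⟩
  have hneg {t : ℝ} (ht : t ∈ Ioo (-1 : ℝ) 1) : -t ∈ Ioo (-1 : ℝ) 1 :=
    ⟨by linarith [ht.2], by linarith [ht.1]⟩
  have hmax (t : Ioo (-1 : ℝ) 1) : max (t : ℝ) 0 ∈ Ico (0 : ℝ) 1 :=
    ⟨le_max_right _ _, max_lt t.2.2 one_pos⟩
  let fwd : Star 2 → Ioo (-1 : ℝ) 1 := Quot.lift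
    (fun p => if p.1 = 0 then ⟨p.2, hIco p.2⟩ else ⟨-p.2, hneg (hIco p.2)⟩) (by
      rintro ⟨i, s⟩ ⟨j, t⟩ ⟨hs, ht⟩
      apply Subtype.ext
      dsimp only at hs ht ⊢
      split_ifs <;> simp [hs, ht])
  let bwd : Ioo (-1 : ℝ) 1 → Star 2 := fun t =>
    if 0 ≤ (t : ℝ) then Quot.mk _ (0, ⟨max (t : ℝ) 0, hmax t⟩)
    else Quot.mk _ (1, ⟨max (-t : ℝ) 0, hmax ⟨-t, hneg t.2⟩⟩)
  have hfwd : Continuous fwd := continuous_quot_lift _ (by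
    refine continuous_prod_of_discrete_left.2 fun i => ?_
    dsimp only
    split_ifs <;> exact Continuous.subtype_mk (by fun_prop) _)
  have hbwd : Continuous bwd := by
    refine Continuous.if_le (continuous_quot_mk.comp (by fun_prop))
      (continuous_quot_mk.comp (by fun_prop)) continuous_const continuous_subtype_val ?_
    intro t ht
    exact Quot.sound (by simp [← ht])
  have hfwd₀ (t : Ico (0 : ℝ) 1) : (fwd (Quot.mk _ (0, t)) : ℝ) = t := rfl
  have hfwd₁ (t : Ico (0 : ℝ) 1) : (fwd (Quot.mk _ (1, t)) : ℝ) = -t := rfl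
  have hbwd₀ (t : Ioo (-1 : ℝ) 1) (ht : 0 ≤ (t : ℝ)) :
      bwd t = Quot.mk _ (0, ⟨t, ht, t.2.2⟩) := by
    refine (if_pos ht).trans ?_
    congr 3
    exact max_eq_left ht
  have hbwd₁ (t : Ioo (-1 : ℝ) 1) (ht : (t : ℝ) ≤ 0) :
      bwd t = Quot.mk _ (1, ⟨-t, neg_nonneg.2 ht, (hneg t.2).2⟩) := by
    rcases ht.eq_or_lt with h | h
    · rw [hbwd₀ t h.ge]
      exact Quot.sound (by simp [h])
    · refine (if_neg (not_le.2 h)).trans ?_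
      congr 3
      exact max_eq_left (neg_nonneg.2 ht)
  refine ⟨⟨⟨fwd, bwd, ?_, ?_⟩, hfwd, hbwd⟩, Quot.mk _ (0, ⟨0, le_rfl, zero_lt_one⟩),
    ⟨0, rfl⟩, rfl⟩
  · rintro ⟨i, t⟩
    rcases eq_or_ne i 0 with rfl | hi
    · exact hbwd₀ _ t.2.1
    · obtain rfl : i = 1 := by omega
      refine (hbwd₁ _ (neg_nonpos.2 t.2.1)).trans ?_
      congr 3
      exact neg_neg (t : ℝ)
  · intro t
    apply Subtype.ext
    rcases le_total 0 (t : ℝ) with h | h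
    · rw [hbwd₀ t h, hfwd₀]
    · rw [hbwd₁ t h, hfwd₁, neg_neg]

theorem IsArcAt.isStarSetAt {Y : Type*} [TopologicalSpace Y] {a : ℝ → Y} {p : Y}
    (ha : IsArcAt a p) : IsStarSetAt (range a) p := by
  obtain ⟨h, c, hc, hc0⟩ := exists_homeomorph_star_two
  obtain ⟨g, hg, hg0, hgr⟩ := exists_isOpenEmbedding_real one_pos
  refine ⟨2, one_lt_two, ((h.trans (Homeomorph.setCongr hgr.symm)).trans
    hg.toIsEmbedding.toHomeomorph.symm).trans ha.1.toIsEmbedding.toHomeomorph, c, hc, ?_⟩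
  have : (Homeomorph.setCongr hgr.symm) (h c) = hg.toIsEmbedding.toHomeomorph 0 :=
    Subtype.ext (hc0.trans hg0.symm)
  simp [this, ha.2]

theorem Star.mk_eq_mk {m : ℕ} {i j : Fin m} {s t : Ico (0 : ℝ) 1} (hs : (s : ℝ) ≠ 0)
    (h : (Quot.mk _ (i, s) : Star m) = Quot.mk _ (j, t)) : i = j := by
  classical
  let tag : Star m → Option (Fin m) := Quot.lift
    (fun p => if (p.2 : ℝ) = 0 then none else some p.1) (by
      rintro ⟨i, s⟩ ⟨j, t⟩ ⟨hs, ht⟩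
      exact (if_pos hs).trans (if_pos ht).symm)
  have h' : (if (s : ℝ) = 0 then none else some i) = if (t : ℝ) = 0 then none else some j :=
    congrArg tag h
  rw [if_neg hs] at h'
  split_ifs at h'
  exact Option.some_injective _ h'

/-- A tripod does not embed in the line: two of the three prongs would leave the center in the same
direction and overlap. -/
theorem not_injective_star_real {m : ℕ} (hm : 2 < m) {f : Star m → ℝ} (hf : Continuous f) :
    ¬Function.Injective f := by
  intro hinj
  let g (i : Fin m) : ℝ → ℝ := fun t => f (Quot.mk _ (i, ⟨projIcc 0 (1 / 2) (by norm_num) t,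
    (projIcc (0 : ℝ) (1 / 2) (by norm_num) t).2.1,
    (projIcc (0 : ℝ) (1 / 2) (by norm_num) t).2.2.trans_lt (by norm_num)⟩))
  have hg (i : Fin m) : Continuous (g i) := hf.comp (continuous_quot_mk.comp
    (continuous_const.prodMk (Continuous.subtype_mk
      (continuous_subtype_val.comp continuous_projIcc) _)))
  have h0 (i j : Fin m) : g i 0 = g j 0 := congrArg f (Quot.sound (by simp))
  -- the half-way value of one prong is not taken on another
  have key (i j : Fin m) (t : ℝ) (h : g i (1 / 2) = g j t) : i = j :=
    Star.mk_eq_mk (by rw [projIcc_of_mem _ (by norm_num)]; norm_num) (hinj h)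
  have hne (i : Fin m) : g i (1 / 2) ≠ g i 0 := by
    intro h
    obtain ⟨j, hj⟩ : ∃ j, i ≠ j := by
      have : Nontrivial (Fin m) := Fin.nontrivial_iff_two_le.2 hm.le
      exact (exists_ne i).imp fun _ h => h.symm
    exact hj (key i j 0 (h.trans (h0 i j)))
  have hup (i j : Fin m) (hi : g i 0 < g i (1 / 2)) (hij : g i (1 / 2) ≤ g j (1 / 2)) : i = j := by
    obtain ⟨t, -, ht⟩ := intermediate_value_Icc (by norm_num) (hg j).continuousOn
      (show g i (1 / 2) ∈ Icc (g j 0) (g j (1 / 2)) from ⟨h0 i j ▸ hi.le, hij⟩)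
    exact key i j t ht.symm
  have hdown (i j : Fin m) (hi : g i (1 / 2) < g i 0) (hij : g j (1 / 2) ≤ g i (1 / 2)) :
      i = j := by
    obtain ⟨t, -, ht⟩ := intermediate_value_Icc' (by norm_num) (hg j).continuousOn
      (show g i (1 / 2) ∈ Icc (g j (1 / 2)) (g j 0) from ⟨hij, h0 i j ▸ hi.le⟩)
    exact key i j t ht.symm
  have hside (i j : Fin m) (h : g i 0 < g i (1 / 2) ↔ g j 0 < g j (1 / 2)) : i = j := by
    rcases lt_or_gt_of_ne (hne i) with hi | hi
    · have hj : g j (1 / 2) < g j 0 :=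
        lt_of_le_of_ne (not_lt.1 fun hj => lt_asymm hi (h.2 hj)) (hne j)
      rcases le_total (g i (1 / 2)) (g j (1 / 2)) with hij | hij
      · exact (hdown j i hj hij).symm
      · exact hdown i j hi hij
    · rcases le_total (g i (1 / 2)) (g j (1 / 2)) with hij | hij
      · exact hup i j hi hij
      · exact (hup j i (h.1 hi) hij).symm
  have hcard := Fintype.card_le_of_injective (fun i => g i 0 < g i (1 / 2))
    (fun i j h => hside i j (iff_of_eq h))
  simp at hcard
  omega

/-! ### Arc neighborhoods in graphs -/

namespace MetricGraph

variable {G : MetricGraph.{u}}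

namespace DirEdge

theorem continuous_param (E : G.DirEdge) : Continuous E.param := by
  rcases E with ⟨e, _ | _⟩
  · exact (continuous_point e).comp (by fun_prop)
  · exact continuous_point e

theorem param_zero (E : G.DirEdge) : E.param 0 = G.vertex E.start := by
  rcases E with ⟨e, _ | _⟩
  · exact point_of_len_le e (by simp)
  · exact point_of_nonpos e le_rfl

/-- Points in the initial halves of directed edges determine the directed edge and the
parameter. -/
theorem param_eq_param {E E' : G.DirEdge} {s t : ℝ} (_ : 0 ≤ s) (hs' : 2 * s < E.length)
    (ht : 0 < t) (ht' : 2 * t < E'.length) (h : E.param s = E'.param t) : E = E' ∧ s = t := by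
  rcases E with ⟨e, _ | _⟩ <;> rcases E' with ⟨e', _ | _⟩ <;>
  · simp only [length] at hs' ht'
    obtain ⟨rfl, h⟩ := (point_eq_point_iff ⟨by linarith, by linarith⟩).1 h
    first
      | exact ⟨rfl, by linarith⟩
      | linarith

end DirEdge

/-- The number of directed edges that start at a vertex is its valence. -/
theorem card_start_eq (v : G.Vert) : Nat.card {E : G.DirEdge // E.start = v} = G.valence v := by
  have := G.finite_edge
  rw [valence, ← Nat.card_sum]
  refine Nat.card_congr ⟨fun E => match E with
    | ⟨(e, true), h⟩ => Sum.inl ⟨e, h⟩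
    | ⟨(e, false), h⟩ => Sum.inr ⟨e, h⟩, Sum.elim (fun e => ⟨(e.1, true), e.2⟩)
      (fun e => ⟨(e.1, false), e.2⟩), ?_, ?_⟩
  · rintro ⟨⟨e, _ | _⟩, h⟩ <;> rfl
  · rintro (e | e) <;> rfl

/-- Outside the natural vertices a graph is locally an arc: inside an edge clearly, and at a vertex
of valence two because the two directed edges that start there fit together. -/
theorem exists_isArcAt (hG : ∀ v, 2 ≤ G.valence v) {p : G.Space} (hp : p ∉ G.naturalVertices) :
    ∃ a, IsArcAt a p := by
  rcases exists_eq_vertex_or_point p with ⟨v, rfl⟩ | ⟨e, t₀, ht₀, rfl⟩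
  · have hv : Nat.card {E : G.DirEdge // E.start = v} = 2 := by
      rw [card_start_eq]
      exact le_antisymm (not_lt.1 fun h => hp ⟨v, h, rfl⟩) (hG v)
    obtain ⟨⟨E₁, h₁⟩, ⟨E₂, h₂⟩, hne, huniv⟩ := Nat.card_eq_two_iff.1 hv
    have hne' : E₁ ≠ E₂ := fun h => hne (Subtype.ext h)
    have hE (E : G.DirEdge) (h : E.start = v) : E = E₁ ∨ E = E₂ := by
      have : (⟨E, h⟩ : {E : G.DirEdge // E.start = v}) ∈ ({⟨E₁, h₁⟩, ⟨E₂, h₂⟩} : Set _) :=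
        huniv ▸ mem_univ _
      simpa using this
    obtain ⟨r, hr', hr⟩ : ∃ r, (∀ e, 2 * r < G.len e) ∧ 0 < r := by
      have := G.finite_edge
      have h : ∀ᶠ r in 𝓝[>] (0 : ℝ), ∀ e, 2 * r < G.len e := Filter.eventually_all.2 fun e =>
        nhdsWithin_le_nhds ((continuous_const.mul continuous_id).continuousAt.eventually_lt
          continuousAt_const (by simpa using G.len_pos e))
      exact (h.and self_mem_nhdsWithin).exists
    have hlen (E : G.DirEdge) {t : ℝ} (ht : t ≤ r) : 2 * t < E.length :=
      (mul_le_mul_of_nonneg_left ht two_pos.le).trans_lt (hr' E.1)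
    let a : ℝ → G.Space := fun t => if 0 ≤ t then E₁.param t else E₂.param (-t)
    have ha₁ {t : ℝ} (ht : 0 ≤ t) : a t = E₁.param t := if_pos ht
    have ha₂ {t : ℝ} (ht : t ≤ 0) : a t = E₂.param (-t) := by
      rcases ht.eq_or_lt with rfl | ht
      · rw [ha₁ le_rfl, neg_zero, DirEdge.param_zero, DirEdge.param_zero, h₁, h₂]
      · exact if_neg (not_le.2 ht)
    have hac : Continuous a := by
      refine E₁.continuous_param.if_le (E₂.continuous_param.comp continuous_neg)
        continuous_const continuous_id fun t ht => ?_
      rw [← ha₁ ht.le, ha₂ ht.ge]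
    have ha0 : a 0 = G.vertex v := by rw [ha₁ le_rfl, DirEdge.param_zero, h₁]
    have hinj : InjOn a (Icc (-r) r) := by
      intro s hs t ht h
      rcases lt_trichotomy t 0 with h0 | rfl | h0
      · rw [ha₂ h0.le] at h
        rcases le_or_gt 0 s with h0' | h0'
        · rw [ha₁ h0'] at h
          exact (hne' (DirEdge.param_eq_param h0' (hlen _ hs.2) (neg_pos.2 h0)
            (hlen _ (by linarith [ht.1])) h).1).elim
        · rw [ha₂ h0'.le] at h
          exact neg_injective (DirEdge.param_eq_param (neg_pos.2 h0').le
            (hlen _ (by linarith [hs.1])) (neg_pos.2 h0) (hlen _ (by linarith [ht.1])) h).2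
      · rcases lt_trichotomy s 0 with h0' | rfl | h0'
        · rw [ha₂ le_rfl, ha₂ h0'.le] at h
          have := (DirEdge.param_eq_param (by simp) (hlen _ (by simp [hr.le])) (neg_pos.2 h0')
            (hlen _ (by linarith [hs.1])) h.symm).2
          linarith
        · rfl
        · rw [ha₁ le_rfl, ha₁ h0'.le] at h
          exact (DirEdge.param_eq_param le_rfl (hlen _ hr.le) h0' (hlen _ hs.2) h.symm).2.symm
      · rw [ha₁ h0.le] at h
        rcases le_or_gt 0 s with h0' | h0'
        · rw [ha₁ h0'] at h
          exact (DirEdge.param_eq_param h0' (hlen _ hs.2) h0 (hlen _ ht.2) h).2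
        · rw [ha₂ h0'.le] at h
          exact (hne' (DirEdge.param_eq_param (neg_pos.2 h0').le (hlen _ (by linarith [hs.1])) h0
            (hlen _ ht.2) h).1.symm).elim
    have hr'' (e : G.Edge) : r < G.len e := by linarith [hr' e]
    have himage : a '' Ioo (-r) r = ball v r := by
      have hmem (E : G.DirEdge) (h : E.start = v) {t : ℝ} (ht : t < r) :
          E.param t ∈ ball v r := by
        rcases E with ⟨e, _ | _⟩
        · exact (point_mem_ball_iff hr hr'').2 (Or.inr ⟨h, by linarith⟩)
        · exact (point_mem_ball_iff hr hr'').2 (Or.inl ⟨h, ht⟩)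
      have hmem' (E : G.DirEdge) (h : E.start = v) {t : ℝ} (ht : t ∈ Ioo 0 r) :
          E.param t ∈ a '' Ioo (-r) r := by
        rcases hE E h with rfl | rfl
        · exact ⟨t, ⟨by linarith [ht.1], ht.2⟩, ha₁ ht.1.le⟩
        · exact ⟨-t, ⟨by linarith [ht.2], by linarith [ht.1]⟩,
            (ha₂ (by linarith [ht.1])).trans (by rw [neg_neg])⟩
      apply subset_antisymm
      · rintro _ ⟨t, ht, rfl⟩
        rcases le_total 0 t with h | h
        · rw [ha₁ h]; exact hmem _ h₁ ht.2
        · rw [ha₂ h]; exact hmem _ h₂ (by linarith [ht.1])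
      · rintro p (rfl | ⟨e, t, ht, rfl, ⟨h, h'⟩ | ⟨h, h'⟩⟩)
        · exact ⟨0, ⟨by linarith, hr⟩, ha0⟩
        · exact hmem' (e, true) h ⟨ht.1, h'⟩
        · have := hmem' (e, false) h (t := G.len e - t) ⟨by linarith [ht.2], by linarith⟩
          simpa [DirEdge.param] using this
    rw [← ha0]
    exact exists_isArcAt_of_injOn hr hac hinj (himage ▸ isOpen_ball v hr hr'')
  · have hr : 0 < min t₀ (G.len e - t₀) / 2 := half_pos (lt_min ht₀.1 (sub_pos.2 ht₀.2))
    set r := min t₀ (G.len e - t₀) / 2 with hr_def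
    have h1 : 2 * r ≤ t₀ := by linarith [min_le_left t₀ (G.len e - t₀)]
    have h2 : 2 * r ≤ G.len e - t₀ := by linarith [min_le_right t₀ (G.len e - t₀)]
    have := exists_isArcAt_of_injOn (a := fun t => G.point e (t₀ + t)) hr
      ((continuous_point e).comp (by fun_prop)) (fun s hs t ht h => by
        have := ((point_eq_point_iff ⟨by linarith [ht.1], by linarith [ht.2]⟩).1 h).2
        linarith) (by
        have h : (fun t => G.point e (t₀ + t)) '' Ioo (-r) r =
            G.point e '' Ioo (t₀ - r) (t₀ + r) := by
          rw [← image_image (G.point e) (t₀ + ·), image_const_add_Ioo, sub_eq_add_neg]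
        rw [h]
        exact isOpen_image_point e (by linarith) (by linarith))
    simpa using this

end MetricGraph

/-! ### Folds and their compositions -/

section Fold

variable {G H : MetricGraph.{u}} {f : G.Space → H.Space}

theorem IsFold.continuous (hf : IsFold f) : Continuous f := by
  obtain ⟨_, _, _, h⟩ := hf
  exact h.quotientMap.continuous

/-- A fold has finite fibers, since it is locally injective along each edge. -/
theorem IsFold.finite_fiber (hf : IsFold f) (y : H.Space) : (f ⁻¹' {y}).Finite := by
  obtain ⟨_, _, _, h⟩ := hf
  have := G.finite_vert
  have := G.finite_edge
  have hedge (e : G.Edge) : {t ∈ Icc 0 (G.len e) | f (G.point e t) = y}.Finite := by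
    have hloc : ∀ t ∈ Icc 0 (G.len e), ∃ U ∈ 𝓝[Icc 0 (G.len e)] t,
        (U ∩ {t ∈ Icc 0 (G.len e) | f (G.point e t) = y}).Finite := by
      intro t ht
      obtain ⟨ε, hε, hiso⟩ := h.isometry_edge e t ht
      refine ⟨Metric.ball t ε, nhdsWithin_le_nhds (Metric.ball_mem_nhds t hε),
        Set.Subsingleton.finite ?_⟩
      rintro r ⟨hr, hr', hry⟩ s ⟨hs, hs', hsy⟩
      have h1 := hiso r hr' s hs' hr hs
      have h2 := hiso r hr' r hr' hr hr
      rw [hry, hsy] at h1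
      rw [hry, h1, sub_self, abs_zero, ENNReal.ofReal_zero, ENNReal.ofReal_eq_zero] at h2
      exact sub_eq_zero.1 (abs_nonpos_iff.1 h2)
    obtain ⟨U, hU, hUfin⟩ : ∃ U ⊇ Icc 0 (G.len e),
        (U ∩ {t ∈ Icc 0 (G.len e) | f (G.point e t) = y}).Finite := by
      refine isCompact_Icc.induction_on (p := fun K => ∃ U ⊇ K,
        (U ∩ {t ∈ Icc 0 (G.len e) | f (G.point e t) = y}).Finite) ⟨∅, subset_rfl, by simp⟩
        (fun _ _ hst ⟨U, hU, h⟩ => ⟨U, hst.trans hU, h⟩)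
        (fun _ _ ⟨U, hU, h⟩ ⟨V, hV, h'⟩ => ⟨U ∪ V, union_subset_union hU hV, ?_⟩)
        (fun t ht => ?_)
      · rw [union_inter_distrib_right]; exact h.union h'
      · obtain ⟨U, hU, h⟩ := hloc t ht
        exact ⟨U, hU, U, subset_rfl, h⟩
    exact hUfin.subset fun t ht => ⟨hU ht.1, ht⟩
  refine ((finite_range G.vertex).union (finite_iUnion fun e => (hedge e).image (G.point e))).subset
    fun p hp => ?_
  rcases MetricGraph.exists_eq_vertex_or_point p with ⟨v, rfl⟩ | ⟨e, t, ht, rfl⟩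
  · exact Or.inl ⟨v, rfl⟩
  · exact Or.inr (mem_iUnion.2 ⟨e, t, ⟨Ioo_subset_Icc_self ht, hp⟩, rfl⟩)

end Fold

namespace SplitSequence

variable {n : ℕ} (ζ : SplitSequence.{u} n)

theorem comp_self (k : ℕ) : ζ.comp (le_refl k) = id :=
  Nat.leRecOn_self (C := fun m => (ζ.graph m).Space → (ζ.graph k).Space) id

theorem comp_succ {i j : ℕ} (h : i ≤ j) :
    ζ.comp (h.trans j.le_succ) = ζ.comp h ∘ ζ.map j := Nat.leRecOn_succ h _

theorem comp_comp {i j k : ℕ} (h : i ≤ j) (h' : j ≤ k) :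
    ζ.comp h ∘ ζ.comp h' = ζ.comp (h.trans h') := by
  induction k, h' using Nat.le_induction with
  | base => rw [comp_self]; rfl
  | succ k hk ih => rw [comp_succ ζ hk, comp_succ ζ (h.trans hk), ← ih]; rfl

theorem continuous_comp {i j : ℕ} (h : i ≤ j) : Continuous (ζ.comp h) := by
  induction j, h using Nat.le_induction with
  | base => rw [comp_self]; exact continuous_id
  | succ k hk ih => rw [comp_succ ζ hk]; exact ih.comp (ζ.fold k).continuous

theorem finite_preimage_comp {i j : ℕ} (h : i ≤ j) {S : Set (ζ.graph i).Space} (hS : S.Finite) :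
    (ζ.comp h ⁻¹' S).Finite := by
  induction j, h using Nat.le_induction with
  | base => rw [comp_self]; exact hS
  | succ k hk ih =>
    rw [comp_succ ζ hk, preimage_comp]
    exact ih.preimage' fun y _ => (ζ.fold k).finite_fiber y

theorem comp_proj {i j : ℕ} (h : i ≤ j) (x : ζ.Solenoid) :
    ζ.comp h (ζ.proj j x) = ζ.proj i x := by
  induction j, h using Nat.le_induction with
  | base => rw [comp_self]; rfl
  | succ k hk ih => rw [comp_succ ζ hk, ← ih, Function.comp_apply]; exact congrArg _ (x.2 k)

theorem continuous_proj (k : ℕ) : Continuous (ζ.proj k) :=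
  (continuous_apply k).comp continuous_subtype_val

theorem nonempty_edge {k : ℕ} (hk : 1 ≤ k) : Nonempty (ζ.graph k).Edge := by
  obtain ⟨k, rfl⟩ := Nat.exists_eq_add_of_le' hk
  obtain ⟨E, -⟩ := ζ.fold k
  exact ⟨E.1⟩

theorem exists_isArcAt {k : ℕ} (hk : 1 ≤ k) {p : (ζ.graph k).Space}
    (hp : p ∉ (ζ.graph k).naturalVertices) : ∃ a, IsArcAt a p := by
  obtain ⟨e⟩ := ζ.nonempty_edge hk
  exact MetricGraph.exists_isArcAt ((ζ.core k).two_le_valence e) hp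

theorem exists_injOn_comp {j l : ℕ} (hjl : j ≤ l) (hl : 1 ≤ l) {p : (ζ.graph l).Space}
    (hp : p ∉ (ζ.graph l).naturalVertices) : ∃ U ∈ 𝓝 p, InjOn (ζ.comp hjl) U := by
  obtain ⟨U, hU, hinj⟩ := ζ.noBacktracking l hl p hp
  refine ⟨U, hU, fun x hx y hy h => hinj hx hy ?_⟩
  change ζ.comp (Nat.zero_le l) x = ζ.comp (Nat.zero_le l) y
  rw [← ζ.comp_comp (Nat.zero_le j) hjl, Function.comp_apply, Function.comp_apply, h]

/-! ### Pre-singularities -/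

/-- Finitely many pre-singularities have distinct natural vertices as coordinates at all
sufficiently deep levels. -/
theorem encard_preSingularity_le :
    {x : ζ.Solenoid | ζ.IsPreSingularity x}.encard ≤ ((2 * (n - 1) : ℕ) : ℕ∞) := by
  by_contra! hlt
  obtain ⟨T, hT, hcard⟩ := exists_subset_encard_eq (Order.add_one_le_of_lt hlt)
  have hfin : T.Finite := finite_of_encard_eq_coe (k := 2 * (n - 1) + 1) (by rw [hcard]; rfl)
  have h1 : ∀ᶠ k in Filter.atTop, ∀ x ∈ T, ζ.proj k x ∈ (ζ.graph k).naturalVertices :=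
    (Filter.eventually_all_finite hfin).2 fun x hx => Filter.eventually_atTop.2 (hT hx)
  have h2 : ∀ᶠ k in Filter.atTop, ∀ x ∈ T, ∀ y ∈ T, ζ.proj k x = ζ.proj k y → x = y := by
    refine (Filter.eventually_all_finite hfin).2 fun x _ =>
      (Filter.eventually_all_finite hfin).2 fun y _ => ?_
    by_cases hxy : x = y
    · exact Filter.Eventually.of_forall fun _ _ => hxy
    obtain ⟨i, hi⟩ : ∃ i, ζ.proj i x ≠ ζ.proj i y := by
      by_contra! h
      exact hxy (Subtype.ext (funext h))
    filter_upwards [Filter.eventually_ge_atTop i] with k hk h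
    rw [← ζ.comp_proj hk, ← ζ.comp_proj hk, h] at hi
    exact (hi rfl).elim
  obtain ⟨k, ⟨hk1, hk2⟩, hk⟩ := ((h1.and h2).and (Filter.eventually_ge_atTop 1)).exists
  obtain ⟨e⟩ := ζ.nonempty_edge hk
  have hle : T.encard ≤ (ζ.graph k).naturalVertices.encard :=
    encard_le_encard_of_injOn hk1 fun x hx y hy h => hk2 x hx y hy h
  rw [hcard, ← MetricGraph.finite_naturalVertices.cast_ncard_eq] at hle
  have := (ζ.core k).ncard_naturalVertices_le e
  have hle' : 2 * (n - 1) + 1 ≤ (ζ.graph k).naturalVertices.ncard := by exact_mod_cast hle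
  omega

/-! ### Singularities -/

theorem finite_isSpecial (hζ : ζ.IsProper) (k : ℕ) : {p | ζ.IsSpecial k p}.Finite := by
  have h1 : (⋃ j : Fin (k + 1),
      ζ.comp (Nat.lt_succ_iff.1 j.2) ⁻¹' (ζ.graph j).naturalVertices).Finite :=
    finite_iUnion fun j => ζ.finite_preimage_comp _ MetricGraph.finite_naturalVertices
  refine (h1.union (ζ.finite_preimage_comp (Nat.zero_le k) hζ)).subset ?_
  rintro p ⟨j, v, hv, hnat⟩
  by_cases hjk : j ≤ k
  · rw [shadow, dif_pos hjk, image_singleton, mem_singleton_iff] at hv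
    exact Or.inl (mem_iUnion.2 ⟨⟨j, Nat.lt_succ_iff.2 hjk⟩, by rw [hv] at hnat; exact hnat⟩)
  · rw [shadow, dif_neg hjk] at hv
    refine Or.inr ⟨j, by omega, v, hnat, ?_⟩
    rw [← ζ.comp_comp (Nat.zero_le k) (not_le.1 hjk).le, Function.comp_apply]
    exact congrArg _ hv

/-- Over an arc of level `j` whose only special point is its center, a plaque whose center has a
coordinate that is not a natural vertex at the level `l` lies on the image of a section of the
composition of folds. -/
theorem exists_section_plaque {j l : ℕ} (hj : 1 ≤ j) (hjl : j < l) {x : ζ.Solenoid}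
    {a : ℝ → (ζ.graph j).Space} (ha : IsArcAt a (ζ.proj j x))
    (hspecial : ∀ q ∈ range a, ζ.IsSpecial j q → q = ζ.proj j x)
    (hx : ζ.proj l x ∉ (ζ.graph l).naturalVertices) :
    ∃ s : ℝ → (ζ.graph l).Space, ∀ y ∈ ζ.plaque (ζ.proj j ⁻¹' range a) x,
      ∀ t, a t = ζ.proj j y → ζ.proj l y = s t := by
  have hl : 1 ≤ l := hj.trans hjl.le
  have hnat {q : (ζ.graph l).Space} {t : ℝ} (hq : ζ.comp hjl.le q = a t) (ht : t ≠ 0) :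
      q ∉ (ζ.graph l).naturalVertices := fun hq' => by
    refine ht (ha.1.injective (ha.2 ▸ hspecial (a t) (mem_range_self t) ⟨l, q, ?_, hq'⟩))
    rw [shadow, dif_neg (not_le.2 hjl)]
    exact hq
  have hloc {q : (ζ.graph l).Space} (hq : q ∉ (ζ.graph l).naturalVertices)
      (hqa : ζ.comp hjl.le q ∈ range a) : IsLocalHomeomorphOn (ζ.comp hjl.le) {q} := by
    obtain ⟨b, hb⟩ := ζ.exists_isArcAt hl hq
    obtain ⟨U, hU, hinj⟩ := ζ.exists_injOn_comp hjl.le hl hq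
    exact isLocalHomeomorphOn_of_injOn (ζ.continuous_comp _) hb ha.1 hqa hU hinj
  obtain ⟨s, hs, hfs, hs0⟩ := exists_section (ζ.continuous_comp hjl.le) ha.1
    (by
      rintro q ⟨t, ht, hqt⟩
      exact hloc (hnat hqt.symm ht) ⟨t, hqt⟩ q rfl)
    (x := ζ.proj l x) (by rw [comp_proj, ha.2]) (hloc hx (by rw [comp_proj, ← ha.2]; simp))
  refine ⟨s, fun y hy t hty => ?_⟩
  obtain ⟨γ, hγ⟩ := hy
  let b (u : unitInterval) : ℝ := ha.1.toIsEmbedding.toHomeomorph.symm ⟨ζ.proj j (γ u), hγ u⟩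
  have hb : Continuous b := ha.1.toIsEmbedding.toHomeomorph.symm.continuous.comp
    (Continuous.subtype_mk ((ζ.continuous_proj j).comp γ.continuous) _)
  have hab (u : unitInterval) : a (b u) = ζ.proj j (γ u) :=
    congrArg Subtype.val (ha.1.toIsEmbedding.toHomeomorph.apply_symm_apply ⟨ζ.proj j (γ u), hγ u⟩)
  -- both sides lift the projection of the path to level `j`, and start at the same point
  have key := eq_of_comp_eq_of_locally_injOn (f := ζ.comp hjl.le) (g₁ := fun u => s (b u))
    (g₂ := fun u => ζ.proj l (γ u)) (hs.comp hb) ((ζ.continuous_proj l).comp γ.continuous)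
    (fun u => by rw [hfs, hab, comp_proj]) (fun u _ => by
      refine ζ.exists_injOn_comp hjl.le hl ?_
      by_cases hu : b u = 0
      · rw [hu, hs0]; exact hx
      · exact hnat (hfs _) hu) (t₀ := 0) (by
      have : b 0 = 0 := ha.1.injective (by rw [hab, γ.source, ha.2])
      rw [this, hs0, γ.source]) 1
  have : b 1 = t := ha.1.injective (by rw [hab, γ.target, hty])
  rw [← this, key, γ.target]

/-- If infinitely many coordinates of a point are not natural vertices, then the plaque through it
in a suitable standard neighborhood injects into an arc, so it is not a star with more than two
prongs. -/
theorem IsSingularity.isPreSingularity (hζ : ζ.IsProper) {x : ζ.Solenoid}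
    (hx : ζ.IsSingularity x) : ζ.IsPreSingularity x := by
  by_contra hpre
  have hinf : ∀ K, ∃ j, K ≤ j ∧ ζ.proj j x ∉ (ζ.graph j).naturalVertices := by
    simpa [IsPreSingularity] using hpre
  obtain ⟨j, hj, hxj⟩ := hinf 1
  obtain ⟨a₀, ha₀⟩ := ζ.exists_isArcAt hj hxj
  have hW : ({p | ζ.IsSpecial j p} \ {ζ.proj j x})ᶜ ∈ 𝓝 (ζ.proj j x) :=
    ((ζ.finite_isSpecial hζ j).sdiff).isClosed.isOpen_compl.mem_nhds (by simp)
  obtain ⟨a, ha, haW⟩ := ha₀.exists_subset hW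
  have hspecial : ∀ q ∈ range a, ζ.IsSpecial j q → q = ζ.proj j x := fun q hq hqs =>
    by_contra fun hne => haW hq ⟨hqs, hne⟩
  set O := ζ.proj j ⁻¹' range a
  obtain ⟨m, hm, -, ⟨h⟩⟩ := hx O
    ⟨j, range a, ⟨ha.1.isOpen_range, _, ha.isStarSetAt, hspecial⟩, rfl⟩ ⟨0, ha.2⟩
  have hmem (y : ζ.plaque O x) : ζ.proj j y.1 ∈ range a :=
    JoinedIn.target_mem (F := O) y.2
  refine not_injective_star_real hm (f := fun t =>
    ha.1.toIsEmbedding.toHomeomorph.symm ⟨ζ.proj j (h t).1, hmem (h t)⟩)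
    (ha.1.toIsEmbedding.toHomeomorph.symm.continuous.comp (Continuous.subtype_mk
      ((ζ.continuous_proj j).comp (continuous_subtype_val.comp h.continuous)) _)) ?_
  refine fun t t' htt => h.injective (Subtype.ext (Subtype.ext (funext fun k => ?_)))
  have heq : ζ.proj j (h t).1 = ζ.proj j (h t').1 :=
    congrArg Subtype.val (ha.1.toIsEmbedding.toHomeomorph.symm.injective htt)
  obtain ⟨l, hl, hxl⟩ := hinf (max k (j + 1))
  obtain ⟨s, hs⟩ := ζ.exists_section_plaque hj (le_of_max_le_right hl) ha hspecial hxl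
  obtain ⟨r, hr⟩ := hmem (h t)
  have hlt : ζ.proj l (h t).1 = ζ.proj l (h t').1 := by
    rw [hs _ (h t).2 r hr, hs _ (h t').2 r (hr.trans heq)]
  change ζ.proj k (h t).1 = ζ.proj k (h t').1
  rw [← ζ.comp_proj (le_of_max_le_left hl), hlt, comp_proj]

end SplitSequence
end SplitSolenoid

theorem mainTheorem5 (n : ℕ) (hn : 1 ≤ n) (ζ : SplitSolenoid.SplitSequence n) (hζ : ζ.IsProper) :
    {x : ζ.Solenoid | ζ.IsPreSingularity x}.encard ≤ ((2 * (n - 1) : ℕ) : ℕ∞) ∧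
      {x : ζ.Solenoid | ζ.IsSingularity x}.encard ≤ ((2 * (n - 1) : ℕ) : ℕ∞) :=
  ⟨ζ.encard_preSingularity_le, (encard_le_encard fun _ hx => hx.isPreSingularity ζ hζ).trans
    ζ.encard_preSingularity_le⟩
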